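/- Consider pure first-order logic: formulae built from atoms $R z_1\ldots z_n$ ($R$ a predicate letter of arity $n\ge 0$, $z_i$ variables) with $\neg,\wedge,\vee,\to,\leftrightarrow,\forall,\exists$, without names, function symbols or identity. A sentence is a formula without free variables. A negation normal form (NNF) contains only $\neg,\wedge,\vee$ as connectives, with $\neg$ only directly in front of atoms. A formula is contradictory if it is false in every structure with nonempty domain under every assignment. The NNF-calculus has the following rules. (a) Equivalence rules, applicable in both directions to any subformula: - $\wedge$I: $A \dashv\vdash A\wedge A$. - Generating NNFs: $A\to B\dashv\vdash \neg A\vee B$; $A\leftrightarrow B\dashv\vdash (A\to B)\wedge(B\to A)$; $\forall x A\dashv\vdash\neg\exists x\neg A$; $\exists x A\dashv\vdash\neg\forall x\neg A$; De Morgan's laws $\neg(A\wedge B)\dashv\vdash\neg A\vee\neg B$ and $\neg(A\vee B)\dashv\vdash\neg A\wedge\neg B$; $\neg\neg A\dashv\vdash A$. - Commutative, associative and distributive laws for $\wedge$ and $\vee$; $\forall x\forall y A\dashv\vdash\forall y\forall x A$; $\exists x\exists y A\dashv\vdash\exists y\exists x A$. - PN laws: for $Q\in\{\forall,\exists\}$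 and $\circ\in\{\wedge,\vee\}$, if $x$ is not free in $A$, then $Qx(A\circ B)\dashv\vdash A\circ QxB$ and $Qx(B\circ A)\dashv\vdash QxB\circ A$; moreover $\forall x(A\wedge B)\dashv\vdash\forall xA\wedge\forall xB$ and $\exists x(A\vee B)\dashv\vdash\exists xA\vee\exists xB$. - Substitution laws: $QxA\dashv\vdash QyA(y/x)$ for $Q\in\{\forall,\exists\}$, if $y$ does not occur in $A$. (b) $\forall$E, applicable to NNFs, at any subformula, from left to right only: if a part $\forall xA$ lies in the scope of a quantifier $\exists y$, then $\forall xA$ may be replaced with $A(y/x)$; here no further quantifier binding $y$ lies between $\exists y$ and $\forall x$, and $y$ is free for $x$ in $A$. If $y$ does not occur in the given (sub)formula at all, one may likewise replace a part $\forall xA$ of it with $A(y/x)$ and put the new quantifier $\exists y$ in front of it. Write $A\vdash B$ if $B$ results from $A$ by finitely many applications of these rules. An explicit contradiction is an NNF without universal quantifiers that can be transformed by PN laws and substitution laws into a formula $\exists y_1\ldots\exists y_n D$ with $D$ quantifier-free, such that in the disjunctive normal form of $D$ obtained by distributing $\wedge$ over $\vee$ each disjunct contains an atom and its negation. **Theorem.**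 The NNF-calculus is correct and complete for proofs of contradiction: 1. If $A\vdash B$, then $B$ is true in every structure with nonempty domain and under every assignment in which $A$ is true. 2. A sentence $A$ is contradictory if and only if $A\vdash B$ for some explicit contradiction $B$. 3. An NNF sentence $A$ is contradictory if and only if there are $C$ and an explicit contradiction $B$ such that $C$ results from $A$ by equivalence rules (a) with only NNFs occurring on the way, and $B$ results from $C$ by applications of $\forall$E alone. -/

import Mathlib

universe u v w

namespace NNFCalculus

/-- Formulae of pure first-order logic over the predicate letters of `L`: no names, no function
symbols, no identity.  The individual variables are the natural numbers. -/
inductive Fml (L : FirstOrder.Language.{u, v}) : Type v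
  | rel {n : ℕ} (R : L.Relations n) (ts : Fin n → ℕ) : Fml L
  | neg (A : Fml L) : Fml L
  | and (A B : Fml L) : Fml L
  | or (A B : Fml L) : Fml L
  | imp (A B : Fml L) : Fml L
  | iff (A B : Fml L) : Fml L
  | all (x : ℕ) (A : Fml L) : Fml L
  | ex (x : ℕ) (A : Fml L) : Fml L

namespace Fml

/-- Truth of a formula in a structure with domain `M` under the assignment `s`. -/
def Realize {L : FirstOrder.Language.{u, v}} {M : Type w} [L.Structure M] : Fml L → (ℕ → M) → Prop
  | rel R ts, s => FirstOrder.Language.Structure.RelMap R (fun i => s (ts i))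
  | neg A, s => ¬ A.Realize s
  | and A B, s => A.Realize s ∧ B.Realize s
  | or A B, s => A.Realize s ∨ B.Realize s
  | imp A B, s => A.Realize s → B.Realize s
  | iff A B, s => A.Realize s ↔ B.Realize s
  | all x A, s => ∀ a : M, A.Realize (Function.update s x a)
  | ex x A, s => ∃ a : M, A.Realize (Function.update s x a)

/-- `A` is contradictory: no structure (with nonempty domain) and assignment make it true. -/
def Contradictory {L : FirstOrder.Language.{u, v}} (A : Fml L) : Prop :=
  ∀ (M : Type w) [Nonempty M] [L.Structure M] (s : ℕ → M), ¬ A.Realize s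

variable {L : FirstOrder.Language.{u, v}}

/-- `x` occurs free in the formula. -/
def FreeIn (x : ℕ) : Fml L → Prop
  | rel _ ts => ∃ i, ts i = x
  | neg A => A.FreeIn x
  | and A B => A.FreeIn x ∨ B.FreeIn x
  | or A B => A.FreeIn x ∨ B.FreeIn x
  | imp A B => A.FreeIn x ∨ B.FreeIn x
  | iff A B => A.FreeIn x ∨ B.FreeIn x
  | all y A => y ≠ x ∧ A.FreeIn x
  | ex y A => y ≠ x ∧ A.FreeIn x

/-- `x` occurs in the formula, free or bound or directly behind a quantifier symbol. -/
def OccursIn (x : ℕ) : Fml L → Prop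
  | rel _ ts => ∃ i, ts i = x
  | neg A => A.OccursIn x
  | and A B => A.OccursIn x ∨ B.OccursIn x
  | or A B => A.OccursIn x ∨ B.OccursIn x
  | imp A B => A.OccursIn x ∨ B.OccursIn x
  | iff A B => A.OccursIn x ∨ B.OccursIn x
  | all y A => y = x ∨ A.OccursIn x
  | ex y A => y = x ∨ A.OccursIn x

/-- A formula without free variables. -/
def IsSentence (A : Fml L) : Prop := ∀ x, ¬ A.FreeIn x

/-- `A.subst x y` is the result of replacing all free occurrences of `x` in `A` with `y`. -/
def subst (x y : ℕ) : Fml L → Fml L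
  | rel R ts => rel R (fun i => if ts i = x then y else ts i)
  | neg A => neg (A.subst x y)
  | and A B => and (A.subst x y) (B.subst x y)
  | or A B => or (A.subst x y) (B.subst x y)
  | imp A B => imp (A.subst x y) (B.subst x y)
  | iff A B => iff (A.subst x y) (B.subst x y)
  | all z A => if z = x then all z A else all z (A.subst x y)
  | ex z A => if z = x then ex z A else ex z (A.subst x y)

/-- `y` is free for `x` in the formula: no free occurrence of `x` lies in the scope of a
quantifier binding `y`. -/
def FreeFor (x y : ℕ) : Fml L → Prop
  | rel _ _ => True
  | neg A => A.FreeFor x y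
  | and A B => A.FreeFor x y ∧ B.FreeFor x y
  | or A B => A.FreeFor x y ∧ B.FreeFor x y
  | imp A B => A.FreeFor x y ∧ B.FreeFor x y
  | iff A B => A.FreeFor x y ∧ B.FreeFor x y
  | all z A => ¬ (all z A).FreeIn x ∨ (z ≠ y ∧ A.FreeFor x y)
  | ex z A => ¬ (ex z A).FreeIn x ∨ (z ≠ y ∧ A.FreeFor x y)

/-- Negation normal forms: only `¬`, `∧`, `∨` as connectives, and `¬` only in front of atoms. -/
def IsNNF : Fml L → Prop
  | rel _ _ => True
  | neg (rel _ _) => True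
  | neg _ => False
  | and A B => A.IsNNF ∧ B.IsNNF
  | or A B => A.IsNNF ∧ B.IsNNF
  | imp _ _ => False
  | iff _ _ => False
  | all _ A => A.IsNNF
  | ex _ A => A.IsNNF

/-- The formula contains no universal quantifier. -/
def NoAll : Fml L → Prop
  | rel _ _ => True
  | neg A => A.NoAll
  | and A B => A.NoAll ∧ B.NoAll
  | or A B => A.NoAll ∧ B.NoAll
  | imp A B => A.NoAll ∧ B.NoAll
  | iff A B => A.NoAll ∧ B.NoAll
  | all _ _ => False
  | ex _ A => A.NoAll

/-- The formula contains no quantifier. -/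
def QuantFree : Fml L → Prop
  | rel _ _ => True
  | neg A => A.QuantFree
  | and A B => A.QuantFree ∧ B.QuantFree
  | or A B => A.QuantFree ∧ B.QuantFree
  | imp A B => A.QuantFree ∧ B.QuantFree
  | iff A B => A.QuantFree ∧ B.QuantFree
  | all _ _ => False
  | ex _ _ => False

/-- The formula `∃ x₁ … ∃ xₙ A`. -/
def exs : List ℕ → Fml L → Fml L
  | [], A => A
  | x :: xs, A => ex x (exs xs A)

/-- The disjunctive normal form of a quantifier-free NNF, obtained by distributing `∧` over `∨`:
the list of its disjuncts, each one given as the list of its conjoined literals. -/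
def dnf : Fml L → List (List (Fml L))
  | or A B => A.dnf ++ B.dnf
  | and A B => A.dnf.flatMap fun c => B.dnf.map fun d => c ++ d
  | A => [[A]]

end Fml

open Fml

variable {L : FirstOrder.Language.{u, v}}

/-- Laws of substitution (renaming of bound variables). -/
inductive SubRule : Fml L → Fml L → Prop
  | sub1 (x y : ℕ) (A : Fml L) : ¬ A.OccursIn y → SubRule (ex x A) (ex y (A.subst x y))
  | sub2 (x y : ℕ) (A : Fml L) : ¬ A.OccursIn y → SubRule (all x A) (all y (A.subst x y))

/-- PN laws. -/
inductive PNRule : Fml L → Fml L → Prop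
  | pn1 (x : ℕ) (A B : Fml L) : ¬ A.FreeIn x → PNRule (all x (and A B)) (and A (all x B))
  | pn2 (x : ℕ) (A B : Fml L) : ¬ A.FreeIn x → PNRule (all x (and B A)) (and (all x B) A)
  | pn3 (x : ℕ) (A B : Fml L) : ¬ A.FreeIn x → PNRule (all x (or A B)) (or A (all x B))
  | pn4 (x : ℕ) (A B : Fml L) : ¬ A.FreeIn x → PNRule (all x (or B A)) (or (all x B) A)
  | pn5 (x : ℕ) (A B : Fml L) : ¬ A.FreeIn x → PNRule (ex x (and A B)) (and A (ex x B))
  | pn6 (x : ℕ) (A B : Fml L) : ¬ A.FreeIn x → PNRule (ex x (and B A)) (and (ex x B) A)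
  | pn7 (x : ℕ) (A B : Fml L) : ¬ A.FreeIn x → PNRule (ex x (or A B)) (or A (ex x B))
  | pn8 (x : ℕ) (A B : Fml L) : ¬ A.FreeIn x → PNRule (ex x (or B A)) (or (ex x B) A)
  | pn9 (x : ℕ) (A B : Fml L) : PNRule (all x (and A B)) (and (all x A) (all x B))
  | pn10 (x : ℕ) (A B : Fml L) : PNRule (ex x (or A B)) (or (ex x A) (ex x B))

/-- Laws for generating NNFs: definitions of connectives and quantifiers, De Morgan's laws and
double negation. -/
inductive NegRule : Fml L → Fml L → Prop
  | impDef (A B : Fml L) : NegRule (imp A B) (or (neg A) B)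
  | iffDef (A B : Fml L) : NegRule (iff A B) (and (imp A B) (imp B A))
  | allDef (x : ℕ) (A : Fml L) : NegRule (all x A) (neg (ex x (neg A)))
  | exDef (x : ℕ) (A : Fml L) : NegRule (ex x A) (neg (all x (neg A)))
  | deMorganAnd (A B : Fml L) : NegRule (neg (and A B)) (or (neg A) (neg B))
  | deMorganOr (A B : Fml L) : NegRule (neg (or A B)) (and (neg A) (neg B))
  | negNeg (A : Fml L) : NegRule (neg (neg A)) A

/-- Associative, commutative and distributive laws for `∧` and `∨`, and commutative laws for
sequences of universal or of existential quantifiers. -/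
inductive LatticeRule : Fml L → Fml L → Prop
  | andComm (A B : Fml L) : LatticeRule (and A B) (and B A)
  | orComm (A B : Fml L) : LatticeRule (or A B) (or B A)
  | andAssoc (A B C : Fml L) : LatticeRule (and (and A B) C) (and A (and B C))
  | orAssoc (A B C : Fml L) : LatticeRule (or (or A B) C) (or A (or B C))
  | andDistrib (A B C : Fml L) : LatticeRule (and A (or B C)) (or (and A B) (and A C))
  | orDistrib (A B C : Fml L) : LatticeRule (or A (and B C)) (and (or A B) (or A C))
  | allComm (x y : ℕ) (A : Fml L) : LatticeRule (all x (all y A)) (all y (all x A))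
  | exComm (x y : ℕ) (A : Fml L) : LatticeRule (ex x (ex y A)) (ex y (ex x A))

/-- The equivalence rules `A ⊣⊢ B` of the NNF-calculus; `andI` is conjunct multiplication. -/
inductive EquivRule : Fml L → Fml L → Prop
  | andI (A : Fml L) : EquivRule A (and A A)
  | sub {A B : Fml L} : SubRule A B → EquivRule A B
  | pn {A B : Fml L} : PNRule A B → EquivRule A B
  | neg {A B : Fml L} : NegRule A B → EquivRule A B
  | lattice {A B : Fml L} : LatticeRule A B → EquivRule A B

/-- `InContext r A B`: `B` results from `A` by rewriting one subformula according to `r`. -/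
inductive InContext (r : Fml L → Fml L → Prop) : Fml L → Fml L → Prop
  | here {A B : Fml L} : r A B → InContext r A B
  | neg {A B : Fml L} : InContext r A B → InContext r (neg A) (neg B)
  | andL {A B : Fml L} (C : Fml L) : InContext r A B → InContext r (and A C) (and B C)
  | andR {A B : Fml L} (C : Fml L) : InContext r A B → InContext r (and C A) (and C B)
  | orL {A B : Fml L} (C : Fml L) : InContext r A B → InContext r (or A C) (or B C)
  | orR {A B : Fml L} (C : Fml L) : InContext r A B → InContext r (or C A) (or C B)
  | impL {A B : Fml L} (C : Fml L) : InContext r A B → InContext r (imp A C) (imp B C)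
  | impR {A B : Fml L} (C : Fml L) : InContext r A B → InContext r (imp C A) (imp C B)
  | iffL {A B : Fml L} (C : Fml L) : InContext r A B → InContext r (iff A C) (iff B C)
  | iffR {A B : Fml L} (C : Fml L) : InContext r A B → InContext r (iff C A) (iff C B)
  | all {A B : Fml L} (x : ℕ) : InContext r A B → InContext r (all x A) (all x B)
  | ex {A B : Fml L} (x : ℕ) : InContext r A B → InContext r (ex x A) (ex x B)

/-- One application, in either direction and to any subformula, of a rule `A ⊣⊢ B` in `r`. -/
def Rewrite (r : Fml L → Fml L → Prop) : Fml L → Fml L → Prop :=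
  InContext fun A B => r A B ∨ r B A

/-- One application of an equivalence rule of the NNF-calculus. -/
def EquivStep : Fml L → Fml L → Prop := Rewrite EquivRule

/-- `Inst y A B`: `B` results from `A` by deleting one quantifier `∀ x` in `A` and replacing the
occurrences of `x` that it binds with `y`; neither the position of `∀ x` nor those of the replaced
occurrences are in the scope of a quantifier of `A` that binds `y`. -/
inductive Inst (y : ℕ) : Fml L → Fml L → Prop
  | elim (x : ℕ) (A : Fml L) : A.FreeFor x y → Inst y (all x A) (A.subst x y)
  | andL {A B : Fml L} (C : Fml L) : Inst y A B → Inst y (and A C) (and B C)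
  | andR {A B : Fml L} (C : Fml L) : Inst y A B → Inst y (and C A) (and C B)
  | orL {A B : Fml L} (C : Fml L) : Inst y A B → Inst y (or A C) (or B C)
  | orR {A B : Fml L} (C : Fml L) : Inst y A B → Inst y (or C A) (or C B)
  | all {A B : Fml L} (z : ℕ) : z ≠ y → Inst y A B → Inst y (all z A) (all z B)
  | ex {A B : Fml L} (z : ℕ) : z ≠ y → Inst y A B → Inst y (ex z A) (ex z B)

/-- Universal quantifier elimination: a universally quantified variable is replaced with the
variable `y` of an existential quantifier that has the universal quantifier in its scope, or with
the variable `y` of a new existential quantifier that is put in front. -/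
inductive AllERule : Fml L → Fml L → Prop
  | scope {y : ℕ} {A B : Fml L} : Inst y A B → AllERule (ex y A) (ex y B)
  | new {y : ℕ} {A B : Fml L} : ¬ A.OccursIn y → Inst y A B → AllERule A (ex y B)

/-- One application of universal quantifier elimination, to any subformula of an NNF. -/
def AllEStep (A B : Fml L) : Prop := A.IsNNF ∧ InContext AllERule A B

/-- `A ⊢ B` in the NNF-calculus. -/
def Derives : Fml L → Fml L → Prop :=
  Relation.ReflTransGen fun A B => EquivStep A B ∨ AllEStep A B

/-- `P` results from `A` by PN laws and renaming of bound variables. -/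
def PrenexTransform : Fml L → Fml L → Prop :=
  Relation.ReflTransGen (Rewrite fun A B => SubRule A B ∨ PNRule A B)

/-- An explicit contradiction: an NNF without universal quantifiers, with a DNF matrix in which
each disjunct contains a literal and its negation. -/
def IsExplicitContradiction (A : Fml L) : Prop :=
  A.IsNNF ∧ A.NoAll ∧ ∃ (xs : List ℕ) (D : Fml L),
    PrenexTransform A (exs xs D) ∧ D.QuantFree ∧
      ∀ c ∈ D.dnf, ∃ (n : ℕ) (R : L.Relations n) (ts : Fin n → ℕ),
        rel R ts ∈ c ∧ neg (rel R ts) ∈ c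

/-- `A` has a proof of contradiction: an explicit contradiction is derivable from `A`. -/
def Refutable (A : Fml L) : Prop := ∃ B, Derives A B ∧ IsExplicitContradiction B

/-- `A` has a proof of contradiction that consists of NNFs and in which all applications of
universal quantifier elimination come last, after the equivalence rules. -/
def RefutableWithinNNF (A : Fml L) : Prop :=
  ∃ C B, Relation.ReflTransGen (fun P Q => P.IsNNF ∧ Q.IsNNF ∧ EquivStep P Q) A C ∧
    Relation.ReflTransGen AllEStep C B ∧ IsExplicitContradiction B

end NNFCalculus

namespace NNFCalculus

open Fml

variable {L : FirstOrder.Language.{u, v}}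

/-! ### Free and bound variables, substitution -/

namespace Fml

/-! Soundness is an induction over contexts. Equivalence rules preserve truth values. Elimination
only preserves truth, but an NNF has no negative context in which an elimination could take place.

Completeness is Herbrand's theorem carried out inside the calculus. Equivalence rules turn the
sentence into an NNF and then into a prenex NNF `P`. One enumeration (`expansion`) lists instances
of `P`: a step picks an earlier instance and replaces its leading variable with a new one. A
variable from an existential quantifier is its own witness; one from a universal quantifier borrows
the witness of an earlier variable, and pairing makes every combination of an instance and an
earlier variable occur. The reserved variable `N` stands for some element of the nonempty domain.

The calculus follows this enumeration: conjunct multiplication copies an instance, renaming makes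
its leading quantifier fresh, and PN laws pull it into a common prefix
(`IsBase.nnfDerives_prefixed`). Each prefix quantifier lies in the scope of all earlier ones, so
universal elimination can replace every universal variable with its witness
(`IsBase.scopedSteps_instantiated`); universal quantifiers left in the matrix are instantiated with
`N`. The outcome contains no universal quantifier, and for such an NNF being contradictory already
means being an explicit contradiction (`isExplicitContradiction_of_contradictory`).

It remains that some finite stage is contradictory. Otherwise every stage has a model. A limit of
these models along an ultrafilter gives a structure on the witnesses in which all quantifier-free
instances hold (`IsBase.exists_realize`), and then `P` holds by induction on the number of
quantifiers left (`IsBase.realize_of_quantFree`). -/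

theorem FreeIn.occursIn {x : ℕ} {A : Fml L} (h : A.FreeIn x) : A.OccursIn x := by
  induction A <;> simp_all [FreeIn, OccursIn] <;> tauto

/-- Truth depends only on the values of the free variables. -/
theorem realize_congr {M : Type w} [L.Structure M] (A : Fml L) {s t : ℕ → M}
    (h : ∀ x, A.FreeIn x → s x = t x) : A.Realize s ↔ A.Realize t := by
  induction A generalizing s t with
  | rel R ts =>
    have : (fun i => s (ts i)) = fun i => t (ts i) := funext fun i => h _ ⟨i, rfl⟩
    simp only [Realize, this]
  | neg A ih => exact not_congr (ih h)
  | and A B ihA ihB =>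
    exact and_congr (ihA fun x hx => h x (.inl hx)) (ihB fun x hx => h x (.inr hx))
  | or A B ihA ihB =>
    exact or_congr (ihA fun x hx => h x (.inl hx)) (ihB fun x hx => h x (.inr hx))
  | imp A B ihA ihB =>
    exact imp_congr (ihA fun x hx => h x (.inl hx)) (ihB fun x hx => h x (.inr hx))
  | iff A B ihA ihB =>
    exact iff_congr (ihA fun x hx => h x (.inl hx)) (ihB fun x hx => h x (.inr hx))
  | all y A ih =>
    refine forall_congr' fun a => ih fun x hx => ?_
    by_cases hxy : x = y
    · simp [hxy]
    · simpa [hxy] using h x ⟨Ne.symm hxy, hx⟩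
  | ex y A ih =>
    refine exists_congr fun a => ih fun x hx => ?_
    by_cases hxy : x = y
    · simp [hxy]
    · simpa [hxy] using h x ⟨Ne.symm hxy, hx⟩

theorem realize_update_of_not_freeIn {M : Type w} [L.Structure M] {A : Fml L} {x : ℕ}
    (h : ¬ A.FreeIn x) (s : ℕ → M) (a : M) :
    A.Realize (Function.update s x a) ↔ A.Realize s :=
  realize_congr A fun y hy => Function.update_of_ne (by rintro rfl; exact h hy) _ _

theorem subst_of_not_freeIn {A : Fml L} {x : ℕ} (y : ℕ) (h : ¬ A.FreeIn x) :
    A.subst x y = A := by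
  induction A with
  | rel R ts =>
    simp only [FreeIn, not_exists] at h
    simp [subst, h]
  | all z A ih | ex z A ih =>
    by_cases hz : z = x
    · simp [subst, hz]
    · simp only [FreeIn, not_and] at h
      simp [subst, hz, ih (h hz)]
  | _ => simp_all [FreeIn, subst]

/-- The substitution lemma. -/
theorem realize_subst {M : Type w} [L.Structure M] {A : Fml L} {x y : ℕ} (h : A.FreeFor x y)
    (s : ℕ → M) : (A.subst x y).Realize s ↔ A.Realize (Function.update s x (s y)) := by
  induction A generalizing s with
  | rel R ts =>
    simp only [subst, Realize]
    refine iff_of_eq (congrArg _ (funext fun i => ?_))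
    by_cases hi : ts i = x <;> simp [hi]
  | all z A ih | ex z A ih =>
    by_cases hf : FreeIn x (all z A)
    · obtain ⟨hzx, hx⟩ := hf
      obtain ⟨hzy, hA⟩ : z ≠ y ∧ A.FreeFor x y := h.resolve_left fun hn => hn ⟨‹_›, hx⟩
      simp only [subst, hzx, if_false, Realize]
      first
      | refine forall_congr' fun a => ?_
      | refine exists_congr fun a => ?_
      rw [ih hA, Function.update_of_ne (Ne.symm hzy), Function.update_comm hzx]
    · first
      | rw [subst_of_not_freeIn y (A := all z A) hf, realize_update_of_not_freeIn hf]
      | have hf' : ¬ FreeIn x (ex z A) := hf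
        rw [subst_of_not_freeIn y hf', realize_update_of_not_freeIn hf']
  | neg A ih => simp only [subst, Realize, ih h]
  | _ A B ihA ihB => simp only [subst, Realize, ihA h.1, ihB h.2]

/-- `x` stands directly behind a quantifier symbol of the formula. -/
def BoundIn (x : ℕ) : Fml L → Prop
  | rel _ _ => False
  | neg A => A.BoundIn x
  | and A B => A.BoundIn x ∨ B.BoundIn x
  | or A B => A.BoundIn x ∨ B.BoundIn x
  | imp A B => A.BoundIn x ∨ B.BoundIn x
  | iff A B => A.BoundIn x ∨ B.BoundIn x
  | all y A => y = x ∨ A.BoundIn x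
  | ex y A => y = x ∨ A.BoundIn x

theorem BoundIn.occursIn {x : ℕ} {A : Fml L} (h : A.BoundIn x) : A.OccursIn x := by
  induction A <;> simp_all [BoundIn, OccursIn] <;> tauto

theorem boundIn_subst {A : Fml L} {x y z : ℕ} : (A.subst x y).BoundIn z ↔ A.BoundIn z := by
  induction A with
  | all w A ih | ex w A ih => by_cases hw : w = x <;> simp [subst, hw, BoundIn, ih]
  | _ => simp_all [subst, BoundIn]

/-- Capture depends only on the bound variables. The weaker hypothesis is needed because a witness
may already occur free in the formula in which it replaces another variable. -/
theorem freeFor_of_not_boundIn {A : Fml L} {x y : ℕ} (h : ¬ A.BoundIn y) : A.FreeFor x y := by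
  induction A <;> simp_all [BoundIn, FreeFor]

theorem freeFor_of_not_occursIn {A : Fml L} {x y : ℕ} (h : ¬ A.OccursIn y) : A.FreeFor x y :=
  freeFor_of_not_boundIn fun hb => h hb.occursIn

theorem OccursIn.of_subst {A : Fml L} {x y z : ℕ} (h : (A.subst x y).OccursIn z) :
    z = y ∨ A.OccursIn z := by
  induction A with
  | rel R ts =>
    obtain ⟨i, hi⟩ := h
    by_cases hx : ts i = x
    · exact .inl (by simpa [hx] using hi.symm)
    · exact .inr ⟨i, by simpa [hx] using hi⟩
  | all w A ih | ex w A ih =>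
    by_cases hw : w = x
    · simp only [subst, hw, if_true] at h
      exact .inr (hw ▸ h)
    · simp only [subst, hw, if_false, OccursIn] at h
      simp only [OccursIn]
      tauto
  | _ => simp only [subst, OccursIn] at h ⊢; tauto

theorem freeIn_subst {A : Fml L} {x y z : ℕ} (h : A.FreeFor x y) :
    (A.subst x y).FreeIn z ↔ (z ≠ x ∧ A.FreeIn z) ∨ (z = y ∧ A.FreeIn x) := by
  induction A with
  | rel R ts =>
    simp only [subst, FreeIn]
    constructor
    · rintro ⟨i, hi⟩
      by_cases hx : ts i = x
      · exact .inr ⟨by simpa [hx] using hi.symm, i, hx⟩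
      · simp only [hx, if_false] at hi
        exact .inl ⟨hi ▸ hx, i, hi⟩
    · rintro (⟨hzx, i, hi⟩ | ⟨rfl, i, hi⟩)
      · exact ⟨i, by simp [hi, hzx]⟩
      · exact ⟨i, by simp [hi]⟩
  | all w A ih | ex w A ih =>
    by_cases hf : FreeIn x (all w A)
    · obtain ⟨hwx, hx⟩ := hf
      obtain ⟨hwy, hA⟩ : w ≠ y ∧ A.FreeFor x y := h.resolve_left fun hn => hn ⟨‹_›, hx⟩
      simp only [subst, hwx, if_false, FreeIn, ih hA]
      constructor
      · rintro ⟨h1, ⟨h2, h3⟩ | ⟨h2, h3⟩⟩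
        exacts [.inl ⟨h2, h1, h3⟩, .inr ⟨h2, hwx, h3⟩]
      · rintro (⟨h1, h2, h3⟩ | ⟨rfl, h2, h3⟩)
        exacts [⟨h2, .inl ⟨h1, h3⟩⟩, ⟨hwy, .inr ⟨rfl, h3⟩⟩]
    · first
      | rw [subst_of_not_freeIn y (A := all w A) hf]
      | rw [subst_of_not_freeIn y (A := ex w A) hf]
      have hf' : ¬ (w ≠ x ∧ A.FreeIn x) := hf
      simp only [FreeIn]
      refine ⟨fun h1 => .inl ⟨?_, h1⟩, fun h1 => h1.elim And.right fun h2 => (hf' h2.2).elim⟩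
      rintro rfl
      exact hf' h1
  | neg A ih => simp only [subst, FreeIn, ih h]
  | _ A B ihA ihB =>
    simp only [subst, FreeIn, ihA h.1, ihB h.2, and_or_left]
    exact or_or_or_comm

theorem isNNF_subst {A : Fml L} {x y : ℕ} : (A.subst x y).IsNNF ↔ A.IsNNF := by
  induction A with
  | neg A ih => cases A <;> simp [subst, IsNNF] <;> split <;> simp [IsNNF]
  | all w A ih | ex w A ih => by_cases hw : w = x <;> simp [subst, hw, IsNNF, ih]
  | _ => simp_all [subst, IsNNF]

theorem noAll_subst {A : Fml L} {x y : ℕ} : (A.subst x y).NoAll ↔ A.NoAll := by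
  induction A with
  | all w A ih | ex w A ih => by_cases hw : w = x <;> simp [subst, hw, NoAll, ih]
  | _ => simp_all [subst, NoAll]

theorem quantFree_subst {A : Fml L} {x y : ℕ} : (A.subst x y).QuantFree ↔ A.QuantFree := by
  induction A with
  | all w A ih | ex w A ih => by_cases hw : w = x <;> simp [subst, hw, QuantFree]
  | _ => simp_all [subst, QuantFree]

theorem exists_bound (A : Fml L) : ∃ N, ∀ x, A.OccursIn x → x < N := by
  induction A with
  | rel R ts =>
    refine ⟨∑ i, ts i + 1, ?_⟩
    rintro x ⟨i, rfl⟩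
    exact Nat.lt_succ_of_le (Finset.single_le_sum (fun _ _ => Nat.zero_le _) (Finset.mem_univ i))
  | neg A ih => exact ih
  | all z A ih | ex z A ih =>
    obtain ⟨N, hN⟩ := ih
    refine ⟨max N (z + 1), ?_⟩
    rintro x (rfl | hx)
    · omega
    · have := hN x hx; omega
  | _ A B ihA ihB =>
    obtain ⟨N, hN⟩ := ihA
    obtain ⟨K, hK⟩ := ihB
    refine ⟨max N K, ?_⟩
    rintro x (hx | hx)
    · have := hN x hx; omega
    · have := hK x hx; omega

end Fml

/-! ### Soundness -/

section Soundness

variable {M : Type w} [L.Structure M]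

theorem InContext.realize_iff {r : Fml L → Fml L → Prop}
    (hr : ∀ A B, r A B → ∀ s : ℕ → M, A.Realize s ↔ B.Realize s) {A B : Fml L}
    (h : InContext r A B) (s : ℕ → M) : A.Realize s ↔ B.Realize s := by
  induction h generalizing s with
  | here h => exact hr _ _ h s
  | all x _ ih => exact forall_congr' fun a => ih _
  | ex x _ ih => exact exists_congr fun a => ih _
  | _ => simp_all [Realize]

theorem SubRule.realize_iff {A B : Fml L} (h : SubRule A B) (s : ℕ → M) :
    A.Realize s ↔ B.Realize s := by
  have key : ∀ (x y : ℕ) (A : Fml L), ¬ A.OccursIn y → ∀ a : M,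
      A.Realize (Function.update s x a) ↔ (A.subst x y).Realize (Function.update s y a) := by
    intro x y A hy a
    rw [realize_subst (freeFor_of_not_occursIn hy)]
    refine realize_congr A fun z hz => ?_
    have hzy : z ≠ y := by rintro rfl; exact hy hz.occursIn
    by_cases hzx : z = x <;> simp [hzx, hzy]
  cases h with
  | sub1 x y A hy => exact exists_congr fun a => key x y A hy a
  | sub2 x y A hy => exact forall_congr' fun a => key x y A hy a

theorem PNRule.realize_iff [Nonempty M] {A B : Fml L} (h : PNRule A B) (s : ℕ → M) :
    A.Realize s ↔ B.Realize s := by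
  cases h with
  | pn9 => simp only [Realize, forall_and]
  | pn10 => simp only [Realize, exists_or]
  | _ x A B hx =>
    simp only [Realize, realize_update_of_not_freeIn hx, forall_and, exists_or, forall_const,
      exists_const, exists_and_left, exists_and_right, forall_or_left, forall_or_right]

theorem EquivRule.realize_iff [Nonempty M] {A B : Fml L} (h : EquivRule A B) (s : ℕ → M) :
    A.Realize s ↔ B.Realize s := by
  cases h with
  | andI => exact (and_self_iff).symm
  | sub h => exact h.realize_iff s
  | pn h => exact h.realize_iff s
  | neg h => cases h <;> simp only [Realize] <;> grind
  | lattice h =>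
    cases h with
    | allComm x y A =>
      by_cases hxy : x = y
      · rw [hxy]
      · simp only [Realize]
        rw [forall_comm]
        simp only [Function.update_comm hxy]
    | exComm x y A =>
      by_cases hxy : x = y
      · rw [hxy]
      · simp only [Realize]
        rw [exists_comm]
        simp only [Function.update_comm hxy]
    | _ => simp only [Realize]; tauto

theorem Rewrite.realize_iff {r : Fml L → Fml L → Prop}
    (hr : ∀ A B, r A B → ∀ s : ℕ → M, A.Realize s ↔ B.Realize s) {A B : Fml L}
    (h : Rewrite r A B) (s : ℕ → M) : A.Realize s ↔ B.Realize s :=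
  InContext.realize_iff (fun A B hAB s => hAB.elim (fun h => hr A B h s)
    fun h => (hr B A h s).symm) h s

theorem EquivStep.realize_iff [Nonempty M] {A B : Fml L} (h : EquivStep A B) (s : ℕ → M) :
    A.Realize s ↔ B.Realize s :=
  Rewrite.realize_iff (fun _ _ h s => h.realize_iff s) h s

theorem PrenexTransform.realize_iff [Nonempty M] {A B : Fml L} (h : PrenexTransform A B)
    (s : ℕ → M) : A.Realize s ↔ B.Realize s := by
  induction h with
  | refl => rfl
  | tail _ h ih =>
    exact ih.trans (Rewrite.realize_iff (fun _ _ h s =>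
      h.elim (fun h => h.realize_iff s) fun h => h.realize_iff s) h s)

theorem Inst.realize {y : ℕ} {A B : Fml L} (h : Inst y A B) (s : ℕ → M) (hA : A.Realize s) :
    B.Realize s := by
  induction h generalizing s with
  | elim x A hf => exact (realize_subst hf s).2 (hA _)
  | andL C _ ih => exact ⟨ih s hA.1, hA.2⟩
  | andR C _ ih => exact ⟨hA.1, ih s hA.2⟩
  | orL C _ ih => exact hA.imp_left (ih s)
  | orR C _ ih => exact hA.imp_right (ih s)
  | all z _ _ ih => exact fun a => ih _ (hA a)
  | ex z _ _ ih => exact hA.imp fun a => ih _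

theorem AllERule.realize [Nonempty M] {A B : Fml L} (h : AllERule A B) (s : ℕ → M)
    (hA : A.Realize s) : B.Realize s := by
  cases h with
  | scope h => exact hA.imp fun a => h.realize _
  -- Since `y` does not occur in `A`, any element may serve as its value.
  | new hy h =>
    exact ⟨Classical.arbitrary M, h.realize _
      ((realize_update_of_not_freeIn (fun hf => hy hf.occursIn) s _).2 hA)⟩

/-- Truth is preserved in one direction only, so the contexts have to be monotone. In an NNF the
only other context is a negated atom, where there is nothing to eliminate. -/
theorem AllEStep.realize [Nonempty M] {A B : Fml L} (h : AllEStep A B) (s : ℕ → M)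
    (hA : A.Realize s) : B.Realize s := by
  obtain ⟨hn, h⟩ := h
  induction h generalizing s with
  | here h => exact h.realize s hA
  | @neg A B h _ =>
    cases A with
    | rel R ts =>
      cases h with
      | here h =>
        cases h with
        | new _ h => cases h
    | _ => exact hn.elim
  | andL C _ ih => exact ⟨ih s hA.1 hn.1, hA.2⟩
  | andR C _ ih => exact ⟨hA.1, ih s hA.2 hn.2⟩
  | orL C _ ih => exact hA.imp_left fun h => ih s h hn.1
  | orR C _ ih => exact hA.imp_right fun h => ih s h hn.2
  | impL | impR | iffL | iffR => exact hn.elim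
  | all x _ ih => exact fun a => ih _ (hA a) hn
  | ex x _ ih => exact hA.imp fun a h => ih _ h hn

theorem Derives.realize [Nonempty M] {A B : Fml L} (h : Derives A B) (s : ℕ → M)
    (hA : A.Realize s) : B.Realize s := by
  induction h with
  | refl => exact hA
  | tail _ h ih => exact h.elim (fun h => (h.realize_iff s).1 ih) fun h => h.realize s ih

theorem Fml.realize_exs {xs : List ℕ} {D : Fml L} {s : ℕ → M} (h : (exs xs D).Realize s) :
    ∃ t : ℕ → M, D.Realize t := by
  induction xs generalizing s with
  | nil => exact ⟨s, h⟩
  | cons x xs ih => exact h.elim fun a h => ih h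

theorem Fml.realize_exs_of_realize {xs : List ℕ} {D : Fml L} {s : ℕ → M} (h : D.Realize s) :
    (exs xs D).Realize s := by
  induction xs with
  | nil => exact h
  | cons x xs ih => exact ⟨s x, by simpa using ih⟩

/-- A formula is equivalent to the disjunction of the conjunctions in its `dnf`. -/
theorem Fml.realize_iff_dnf (D : Fml L) (s : ℕ → M) :
    D.Realize s ↔ ∃ c ∈ D.dnf, ∀ A ∈ c, A.Realize s := by
  induction D with
  | and A B ihA ihB =>
    simp only [Realize, ihA, ihB, dnf, List.mem_flatMap, List.mem_map]
    constructor
    · rintro ⟨⟨c, hc, h⟩, d, hd, h'⟩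
      exact ⟨_, ⟨c, hc, d, hd, rfl⟩, fun A hA => (List.mem_append.1 hA).elim (h A) (h' A)⟩
    · rintro ⟨_, ⟨c, hc, d, hd, rfl⟩, h⟩
      exact ⟨⟨c, hc, fun A hA => h A (List.mem_append_left _ hA)⟩,
        d, hd, fun A hA => h A (List.mem_append_right _ hA)⟩
  | or A B ihA ihB =>
    simp only [Realize, ihA, ihB, dnf, List.mem_append, or_and_right, exists_or]
  | _ => simp [dnf]

theorem IsExplicitContradiction.not_realize [Nonempty M] {A : Fml L}
    (h : IsExplicitContradiction A) (s : ℕ → M) : ¬ A.Realize s := by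
  intro hA
  obtain ⟨-, -, xs, D, hP, -, hD⟩ := h
  obtain ⟨t, ht⟩ := realize_exs ((hP.realize_iff s).1 hA)
  obtain ⟨c, hc, h⟩ := (realize_iff_dnf D t).1 ht
  obtain ⟨n, R, ts, h1, h2⟩ := hD c hc
  exact h _ h2 (h _ h1)

end Soundness

/-- Refutations are sound. -/
theorem Refutable.contradictory {A : Fml L} (h : Refutable A) : Contradictory.{u, v, w} A := by
  obtain ⟨B, hB, hc⟩ := h
  exact fun M _ _ s hA => hc.not_realize s (hB.realize s hA)

theorem RefutableWithinNNF.refutable {A : Fml L} (h : RefutableWithinNNF A) : Refutable A := by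
  obtain ⟨C, B, h1, h2, hB⟩ := h
  have h1' : Derives A C := Relation.ReflTransGen.mono (fun _ _ h => Or.inl h.2.2) _ _ h1
  have h2' : Derives C B := Relation.ReflTransGen.mono (fun _ _ h => Or.inr h) _ _ h2
  exact ⟨B, h1'.trans h2', hB⟩

/-! ### Invariance of the free variables under equivalence rules -/

section FreeVariables

theorem InContext.freeIn_iff {r : Fml L → Fml L → Prop} {x : ℕ}
    (hr : ∀ A B, r A B → (A.FreeIn x ↔ B.FreeIn x)) {A B : Fml L} (h : InContext r A B) :
    A.FreeIn x ↔ B.FreeIn x := by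
  induction h with
  | here h => exact hr _ _ h
  | _ => simp_all [FreeIn]

theorem EquivRule.freeIn_iff {A B : Fml L} (h : EquivRule A B) (x : ℕ) :
    A.FreeIn x ↔ B.FreeIn x := by
  cases h with
  | andI => exact (or_self_iff).symm
  | sub h =>
    cases h with
    | sub1 z y A hy | sub2 z y A hy =>
      have hy' : ¬ A.FreeIn y := fun h => hy h.occursIn
      simp only [FreeIn, freeIn_subst (freeFor_of_not_occursIn hy)]
      grind
  | pn h =>
    cases h with
    | pn9 | pn10 => simp only [FreeIn]; tauto
    | _ z A B hz => simp only [FreeIn]; grind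
  | neg h => cases h <;> simp only [FreeIn] <;> try tauto
  | lattice h => cases h <;> simp only [FreeIn] <;> tauto

theorem EquivStep.freeIn_iff {A B : Fml L} (h : EquivStep A B) (x : ℕ) :
    A.FreeIn x ↔ B.FreeIn x :=
  InContext.freeIn_iff (fun _ _ h => h.elim (fun h => h.freeIn_iff x)
    fun h => (h.freeIn_iff x).symm) h

theorem Fml.IsSentence.of_equivSteps {A B : Fml L} (hA : A.IsSentence)
    (h : Relation.ReflTransGen EquivStep A B) : B.IsSentence := by
  induction h with
  | refl => exact hA
  | tail _ h ih => exact fun x hx => ih x ((h.freeIn_iff x).2 hx)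

end FreeVariables

/-! ### Negation normal forms -/

section NegationNormalForm

/-- The formula can be transformed into a negation normal form by equivalence rules. -/
def HasNNF (A : Fml L) : Prop := ∃ B : Fml L, B.IsNNF ∧ Relation.ReflTransGen EquivStep A B

theorem Fml.IsNNF.hasNNF {A : Fml L} (h : A.IsNNF) : HasNNF A := ⟨A, h, .refl⟩

theorem HasNNF.head {A B : Fml L} (h : EquivStep A B) : HasNNF B → HasNNF A
  | ⟨C, hC, hBC⟩ => ⟨C, hC, .head h hBC⟩

theorem HasNNF.rule {A B : Fml L} (h : NegRule A B) : HasNNF B → HasNNF A :=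
  .head (.here (.inl (.neg h)))

theorem HasNNF.neg_rule {A B : Fml L} (h : NegRule A B) :
    HasNNF (Fml.neg B) → HasNNF (Fml.neg A) :=
  .head (.neg (.here (.inl (.neg h))))

theorem HasNNF.and {A B : Fml L} : HasNNF A → HasNNF B → HasNNF (and A B)
  | ⟨C, hC, hAC⟩, ⟨D, hD, hBD⟩ => ⟨Fml.and C D, And.intro hC hD,
    (hAC.lift (fun A => Fml.and A B) fun _ _ h => .andL B h).trans
      (hBD.lift (fun B => Fml.and C B) fun _ _ h => .andR C h)⟩

theorem HasNNF.or {A B : Fml L} : HasNNF A → HasNNF B → HasNNF (or A B)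
  | ⟨C, hC, hAC⟩, ⟨D, hD, hBD⟩ => ⟨Fml.or C D, And.intro hC hD,
    (hAC.lift (fun A => Fml.or A B) fun _ _ h => .orL B h).trans
      (hBD.lift (fun B => Fml.or C B) fun _ _ h => .orR C h)⟩

theorem HasNNF.all {A : Fml L} (x : ℕ) : HasNNF A → HasNNF (all x A)
  | ⟨C, hC, hAC⟩ => ⟨Fml.all x C, hC, hAC.lift _ fun _ _ h => .all x h⟩

theorem HasNNF.ex {A : Fml L} (x : ℕ) : HasNNF A → HasNNF (ex x A)
  | ⟨C, hC, hAC⟩ => ⟨Fml.ex x C, hC, hAC.lift _ fun _ _ h => .ex x h⟩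

theorem HasNNF.negNeg {A : Fml L} : HasNNF A → HasNNF (Fml.neg (Fml.neg A)) :=
  .rule (.negNeg A)

theorem HasNNF.imp {A B : Fml L} (hA : HasNNF (Fml.neg A)) (hB : HasNNF B) : HasNNF (imp A B) :=
  .rule (.impDef A B) (.or hA hB)

theorem HasNNF.neg_imp {A B : Fml L} (hA : HasNNF A) (hB : HasNNF (Fml.neg B)) :
    HasNNF (Fml.neg (Fml.imp A B)) :=
  .neg_rule (.impDef A B) (.rule (.deMorganOr _ _) (.and hA.negNeg hB))

/-- Pushing a negation inwards calls for the negations of the subformulae, so both claims go through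
the induction together. -/
theorem hasNNF_and_hasNNF_neg (A : Fml L) : HasNNF A ∧ HasNNF (Fml.neg A) := by
  induction A with
  | rel R ts => exact ⟨IsNNF.hasNNF trivial, IsNNF.hasNNF trivial⟩
  | neg A ih => exact ⟨ih.2, ih.1.negNeg⟩
  | and A B ihA ihB =>
    exact ⟨.and ihA.1 ihB.1, .rule (.deMorganAnd A B) (.or ihA.2 ihB.2)⟩
  | or A B ihA ihB =>
    exact ⟨.or ihA.1 ihB.1, .rule (.deMorganOr A B) (.and ihA.2 ihB.2)⟩
  | imp A B ihA ihB => exact ⟨.imp ihA.2 ihB.1, .neg_imp ihA.1 ihB.2⟩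
  | iff A B ihA ihB =>
    exact ⟨.rule (.iffDef A B) (.and (.imp ihA.2 ihB.1) (.imp ihB.2 ihA.1)),
      .neg_rule (.iffDef A B) (.rule (.deMorganAnd _ _)
        (.or (.neg_imp ihA.1 ihB.2) (.neg_imp ihB.1 ihA.2)))⟩
  | all x A ih => exact ⟨.all x ih.1, .neg_rule (.allDef x A) (.negNeg (.ex x ih.2))⟩
  | ex x A ih => exact ⟨.ex x ih.1, .neg_rule (.exDef x A) (.negNeg (.all x ih.2))⟩

end NegationNormalForm

/-! ### Prenex forms and explicit contradictions -/

section Prenex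

/-- A prenex normal form with `n` quantifiers. -/
inductive IsPrenex : ℕ → Fml L → Prop
  | qf {A : Fml L} : A.QuantFree → IsPrenex 0 A
  | all {n : ℕ} (x : ℕ) {A : Fml L} : IsPrenex n A → IsPrenex (n + 1) (all x A)
  | ex {n : ℕ} (x : ℕ) {A : Fml L} : IsPrenex n A → IsPrenex (n + 1) (ex x A)

theorem Fml.QuantFree.subst {A : Fml L} (h : A.QuantFree) (x y : ℕ) : (A.subst x y).QuantFree :=
  quantFree_subst.2 h

theorem IsPrenex.subst {n : ℕ} {A : Fml L} (h : IsPrenex n A) (x y : ℕ) :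
    IsPrenex n (A.subst x y) := by
  induction h with
  | qf h => exact .qf (h.subst x y)
  | all z h ih =>
    rw [Fml.subst]; split
    exacts [.all z h, .all z ih]
  | ex z h ih =>
    rw [Fml.subst]; split
    exacts [.ex z h, .ex z ih]

theorem PrenexTransform.andL {A B : Fml L} (C : Fml L) (h : PrenexTransform A B) :
    PrenexTransform (and A C) (and B C) :=
  h.lift (fun A => and A C) fun _ _ h => .andL C h

theorem PrenexTransform.andR {A B : Fml L} (C : Fml L) (h : PrenexTransform A B) :
    PrenexTransform (and C A) (and C B) :=
  h.lift (fun A => and C A) fun _ _ h => .andR C h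

theorem PrenexTransform.orL {A B : Fml L} (C : Fml L) (h : PrenexTransform A B) :
    PrenexTransform (or A C) (or B C) :=
  h.lift (fun A => or A C) fun _ _ h => .orL C h

theorem PrenexTransform.orR {A B : Fml L} (C : Fml L) (h : PrenexTransform A B) :
    PrenexTransform (or C A) (or C B) :=
  h.lift (fun A => or C A) fun _ _ h => .orR C h

theorem PrenexTransform.all {A B : Fml L} (x : ℕ) (h : PrenexTransform A B) :
    PrenexTransform (all x A) (all x B) :=
  h.lift (fun A => Fml.all x A) fun _ _ h => .all x h

theorem PrenexTransform.ex {A B : Fml L} (x : ℕ) (h : PrenexTransform A B) :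
    PrenexTransform (ex x A) (ex x B) :=
  h.lift (fun A => Fml.ex x A) fun _ _ h => .ex x h

theorem PrenexTransform.sub {A B : Fml L} (h : SubRule A B) : PrenexTransform A B :=
  .single (.here (.inl (.inl h)))

theorem PrenexTransform.pn_symm {A B : Fml L} (h : PNRule A B) : PrenexTransform B A :=
  .single (.here (.inr (.inr h)))

/-- Quantifiers can be pulled out of a binary connective that satisfies the PN laws. -/
theorem exists_isPrenex_of_op (op : Fml L → Fml L → Fml L)
    (hL : ∀ {A B : Fml L} (C : Fml L), PrenexTransform A B → PrenexTransform (op A C) (op B C))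
    (hR : ∀ {A B : Fml L} (C : Fml L), PrenexTransform A B → PrenexTransform (op C A) (op C B))
    (hqf : ∀ {A B : Fml L}, A.QuantFree → B.QuantFree → (op A B).QuantFree)
    (hallL : ∀ x A B, ¬ A.FreeIn x → PrenexTransform (op (Fml.all x B) A) (Fml.all x (op B A)))
    (hallR : ∀ x A B, ¬ A.FreeIn x → PrenexTransform (op A (Fml.all x B)) (Fml.all x (op A B)))
    (hexL : ∀ x A B, ¬ A.FreeIn x → PrenexTransform (op (Fml.ex x B) A) (Fml.ex x (op B A)))
    (hexR : ∀ x A B, ¬ A.FreeIn x → PrenexTransform (op A (Fml.ex x B)) (Fml.ex x (op A B)))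
    {n m : ℕ} {A B : Fml L} (hA : IsPrenex n A) (hB : IsPrenex m B) :
    ∃ k C, IsPrenex k C ∧ PrenexTransform (op A B) C := by
  have fresh : ∀ A B : Fml L, ∃ y, ¬ A.OccursIn y ∧ ¬ B.FreeIn y := fun A B => by
    obtain ⟨N, hN⟩ := A.exists_bound
    obtain ⟨K, hK⟩ := B.exists_bound
    refine ⟨max N K, fun h => ?_, fun h => ?_⟩
    · exact absurd (hN _ h) (by omega)
    · exact absurd (hK _ h.occursIn) (by omega)
  -- The induction is on the numbers of quantifiers: once its bound variable is renamed, the scope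
  -- of a quantifier is no longer a subformula.
  induction n generalizing A B m with
  | zero =>
    cases hA with
    | qf hA =>
      induction m generalizing B with
      | zero =>
        cases hB with
        | qf hB => exact ⟨0, _, .qf (hqf hA hB), .refl⟩
      | succ m ih =>
        cases hB with
        | @all _ x B hB =>
          obtain ⟨y, hy, hyA⟩ := fresh B A
          obtain ⟨k, C, hC, h⟩ := ih (hB.subst x y)
          exact ⟨k + 1, _, .all y hC,
            ((hR A (.sub (.sub2 x y B hy))).trans (hallR y A _ hyA)).trans (h.all y)⟩
        | @ex _ x B hB =>
          obtain ⟨y, hy, hyA⟩ := fresh B A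
          obtain ⟨k, C, hC, h⟩ := ih (hB.subst x y)
          exact ⟨k + 1, _, .ex y hC,
            ((hR A (.sub (.sub1 x y B hy))).trans (hexR y A _ hyA)).trans (h.ex y)⟩
  | succ n ih =>
    cases hA with
    | @all _ x A hA =>
      obtain ⟨y, hy, hyB⟩ := fresh A B
      obtain ⟨k, C, hC, h⟩ := ih (hA.subst x y) hB
      exact ⟨k + 1, _, .all y hC,
        ((hL B (.sub (.sub2 x y A hy))).trans (hallL y B _ hyB)).trans (h.all y)⟩
    | @ex _ x A hA =>
      obtain ⟨y, hy, hyB⟩ := fresh A B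
      obtain ⟨k, C, hC, h⟩ := ih (hA.subst x y) hB
      exact ⟨k + 1, _, .ex y hC,
        ((hL B (.sub (.sub1 x y A hy))).trans (hexL y B _ hyB)).trans (h.ex y)⟩

/-- Every negation normal form has a prenex normal form. -/
theorem Fml.IsNNF.exists_isPrenex {A : Fml L} (h : A.IsNNF) :
    ∃ n C, IsPrenex n C ∧ PrenexTransform A C := by
  induction A with
  | rel R ts => exact ⟨0, rel R ts, .qf trivial, .refl⟩
  | neg A =>
    cases A with
    | rel R ts => exact ⟨0, Fml.neg (rel R ts), .qf trivial, .refl⟩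
    | _ => exact h.elim
  | and A B ihA ihB =>
    obtain ⟨n, P, hP, hA⟩ := ihA h.1
    obtain ⟨m, Q, hQ, hB⟩ := ihB h.2
    obtain ⟨k, C, hC, hPQ⟩ := exists_isPrenex_of_op Fml.and .andL .andR And.intro
      (fun x A B h => .pn_symm (.pn2 x A B h)) (fun x A B h => .pn_symm (.pn1 x A B h))
      (fun x A B h => .pn_symm (.pn6 x A B h)) (fun x A B h => .pn_symm (.pn5 x A B h)) hP hQ
    exact ⟨k, C, hC, ((hA.andL B).trans (hB.andR P)).trans hPQ⟩
  | or A B ihA ihB =>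
    obtain ⟨n, P, hP, hA⟩ := ihA h.1
    obtain ⟨m, Q, hQ, hB⟩ := ihB h.2
    obtain ⟨k, C, hC, hPQ⟩ := exists_isPrenex_of_op Fml.or .orL .orR And.intro
      (fun x A B h => .pn_symm (.pn4 x A B h)) (fun x A B h => .pn_symm (.pn3 x A B h))
      (fun x A B h => .pn_symm (.pn8 x A B h)) (fun x A B h => .pn_symm (.pn7 x A B h)) hP hQ
    exact ⟨k, C, hC, ((hA.orL B).trans (hB.orR P)).trans hPQ⟩
  | imp | iff => exact h.elim
  | all x A ih =>
    obtain ⟨n, C, hC, hA⟩ := ih h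
    exact ⟨n + 1, _, .all x hC, hA.all x⟩
  | ex x A ih =>
    obtain ⟨n, C, hC, hA⟩ := ih h
    exact ⟨n + 1, _, .ex x hC, hA.ex x⟩

/-- Neither side of such a rule is an atom, so a negation in front of it never gives an NNF. This
strengthening carries the induction over contexts through `neg`. -/
theorem Fml.isNNF_iff_of_prenexRule {A B : Fml L} (h : SubRule A B ∨ PNRule A B) :
    (A.IsNNF ↔ B.IsNNF) ∧ ¬ (Fml.neg A).IsNNF ∧ ¬ (Fml.neg B).IsNNF := by
  rcases h with h | h <;> cases h <;> simp [IsNNF, isNNF_subst]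

theorem isNNF_iff_of_prenexStep {A B : Fml L}
    (h : Rewrite (fun A B : Fml L => SubRule A B ∨ PNRule A B) A B) : A.IsNNF ↔ B.IsNNF := by
  suffices (A.IsNNF ↔ B.IsNNF) ∧ ¬ (Fml.neg A).IsNNF ∧ ¬ (Fml.neg B).IsNNF from this.1
  induction h with
  | here h =>
    rcases h with h | h
    · exact isNNF_iff_of_prenexRule h
    · have := isNNF_iff_of_prenexRule h
      exact ⟨this.1.symm, this.2.2, this.2.1⟩
  | _ => simp_all [IsNNF]

theorem noAll_iff_of_prenexStep {A B : Fml L}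
    (h : Rewrite (fun A B : Fml L => SubRule A B ∨ PNRule A B) A B) : A.NoAll ↔ B.NoAll := by
  have key : ∀ A B : Fml L, SubRule A B ∨ PNRule A B → (A.NoAll ↔ B.NoAll) := by
    rintro A B (h | h) <;> cases h <;> simp [NoAll, noAll_subst]
  induction h with
  | here h => exact h.elim (key _ _) fun h => (key _ _ h).symm
  | _ => simp_all [NoAll]

theorem PrenexTransform.isNNF_iff {A B : Fml L} (h : PrenexTransform A B) :
    A.IsNNF ↔ B.IsNNF := by
  induction h with
  | refl => rfl
  | tail _ h ih => exact ih.trans (isNNF_iff_of_prenexStep h)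

theorem PrenexTransform.noAll_iff {A B : Fml L} (h : PrenexTransform A B) :
    A.NoAll ↔ B.NoAll := by
  induction h with
  | refl => rfl
  | tail _ h ih => exact ih.trans (noAll_iff_of_prenexStep h)

theorem IsPrenex.exists_eq_exs {n : ℕ} {A : Fml L} (h : IsPrenex n A) (ha : A.NoAll)
    (hn : A.IsNNF) : ∃ xs D, A = exs xs D ∧ D.QuantFree ∧ D.IsNNF := by
  induction h with
  | qf h => exact ⟨[], _, rfl, h, hn⟩
  | all => exact ha.elim
  | ex x _ ih =>
    obtain ⟨xs, D, rfl, h⟩ := ih ha hn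
    exact ⟨x :: xs, D, rfl, h⟩

theorem Fml.exists_eq_rel_of_mem_dnf {D : Fml L} (hq : D.QuantFree) (hn : D.IsNNF)
    {c : List (Fml L)} (hc : c ∈ D.dnf) {A : Fml L} (hA : A ∈ c) :
    ∃ (n : ℕ) (R : L.Relations n) (ts : Fin n → ℕ), A = rel R ts ∨ A = Fml.neg (rel R ts) := by
  induction D generalizing c with
  | rel R ts =>
    simp only [dnf, List.mem_singleton] at hc
    subst hc
    exact ⟨_, R, ts, .inl (List.mem_singleton.1 hA)⟩
  | neg B =>
    cases B with
    | rel R ts =>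
      simp only [dnf, List.mem_singleton] at hc
      subst hc
      exact ⟨_, R, ts, .inr (List.mem_singleton.1 hA)⟩
    | _ => exact hn.elim
  | and B C ihB ihC =>
    simp only [dnf, List.mem_flatMap, List.mem_map] at hc
    obtain ⟨c, hc, d, hd, rfl⟩ := hc
    exact (List.mem_append.1 hA).elim (ihB hq.1 hn.1 hc) (ihC hq.2 hn.2 hd)
  | or B C ihB ihC =>
    exact (List.mem_append.1 hc).elim (fun hc => ihB hq.1 hn.1 hc hA) fun hc => ihC hq.2 hn.2 hc hA
  | imp | iff => exact hn.elim
  | all | ex => exact hq.elim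

/-- A contradictory negation normal form without universal quantifiers is an explicit
contradiction. -/
theorem isExplicitContradiction_of_contradictory {B : Fml L} (hn : B.IsNNF) (ha : B.NoAll)
    (hc : Contradictory.{u, v, w} B) : IsExplicitContradiction B := by
  obtain ⟨n, P, hP, hBP⟩ := hn.exists_isPrenex
  obtain ⟨xs, D, rfl, hq, hD⟩ := hP.exists_eq_exs (hBP.noAll_iff.1 ha) (hBP.isNNF_iff.1 hn)
  refine ⟨hn, ha, xs, D, hBP, hq, fun c hcD => ?_⟩
  by_contra hpair
  -- Every variable denotes itself, and a predicate holds of exactly the tuples for which its atom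
  -- is in `c`. A negated atom of `c` is then true because `c` contains no complementary pair.
  let _ : L.Structure (ULift.{w} ℕ) :=
    { funMap := fun _ _ => ⟨0⟩
      RelMap := fun R ts => rel R (fun i => (ts i).down) ∈ c }
  refine hc (ULift.{w} ℕ) ULift.up ((hBP.realize_iff _).2 (realize_exs_of_realize
    ((realize_iff_dnf D _).2 ⟨c, hcD, fun A hA => ?_⟩)))
  obtain ⟨n, R, ts, rfl | rfl⟩ := exists_eq_rel_of_mem_dnf hq hD hcD hA
  · exact hA
  · exact fun h => hpair ⟨n, R, ts, h, hA⟩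

end Prenex

/-! ### Derivations by equivalence rules within NNFs -/

section NNFDerives

/-- `B` results from `A` by equivalence rules, with only NNFs occurring on the way. -/
def NNFDerives : Fml L → Fml L → Prop :=
  Relation.ReflTransGen fun A B => A.IsNNF ∧ B.IsNNF ∧ EquivStep A B

theorem NNFDerives.rule {A B : Fml L} (h : EquivRule A B) (hA : A.IsNNF) (hB : B.IsNNF) :
    NNFDerives A B := .single ⟨hA, hB, .here (.inl h)⟩

theorem NNFDerives.rule_symm {A B : Fml L} (h : EquivRule A B) (hA : A.IsNNF) (hB : B.IsNNF) :
    NNFDerives B A := .single ⟨hB, hA, .here (.inr h)⟩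

theorem NNFDerives.trans {A B C : Fml L} (h : NNFDerives A B) (h' : NNFDerives B C) :
    NNFDerives A C := Relation.ReflTransGen.trans h h'

theorem NNFDerives.andL {A B C : Fml L} (hC : C.IsNNF) (h : NNFDerives A B) :
    NNFDerives (and A C) (and B C) :=
  h.lift (fun A => and A C) fun _ _ h => ⟨⟨h.1, hC⟩, ⟨h.2.1, hC⟩, .andL C h.2.2⟩

theorem NNFDerives.andR {A B C : Fml L} (hC : C.IsNNF) (h : NNFDerives A B) :
    NNFDerives (and C A) (and C B) :=
  h.lift (fun A => and C A) fun _ _ h => ⟨⟨hC, h.1⟩, ⟨hC, h.2.1⟩, .andR C h.2.2⟩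

theorem NNFDerives.all {A B : Fml L} (x : ℕ) (h : NNFDerives A B) :
    NNFDerives (all x A) (all x B) :=
  h.lift (fun A => Fml.all x A) fun _ _ h => ⟨h.1, h.2.1, .all x h.2.2⟩

theorem NNFDerives.ex {A B : Fml L} (x : ℕ) (h : NNFDerives A B) :
    NNFDerives (ex x A) (ex x B) :=
  h.lift (fun A => Fml.ex x A) fun _ _ h => ⟨h.1, h.2.1, .ex x h.2.2⟩

theorem PrenexTransform.nnfDerives {A B : Fml L} (h : PrenexTransform A B) (hA : A.IsNNF) :
    NNFDerives A B := by
  induction h with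
  | refl => exact .refl
  | @tail B C h hBC ih =>
    have hB : B.IsNNF := (PrenexTransform.isNNF_iff h).1 hA
    refine .tail ih ⟨hB, (isNNF_iff_of_prenexStep hBC).1 hB, ?_⟩
    clear ih h hB
    have key : ∀ A B : Fml L, SubRule A B ∨ PNRule A B → EquivRule A B := fun A B h =>
      h.elim .sub .pn
    induction hBC with
    | here h => exact .here (h.imp (key _ _) (key _ _))
    | neg _ ih => exact .neg ih
    | andL C _ ih => exact .andL C ih
    | andR C _ ih => exact .andR C ih
    | orL C _ ih => exact .orL C ih
    | orR C _ ih => exact .orR C ih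
    | impL C _ ih => exact .impL C ih
    | impR C _ ih => exact .impR C ih
    | iffL C _ ih => exact .iffL C ih
    | iffR C _ ih => exact .iffR C ih
    | all x _ ih => exact .all x ih
    | ex x _ ih => exact .ex x ih

theorem NNFDerives.equivSteps {A B : Fml L} (h : NNFDerives A B) :
    Relation.ReflTransGen EquivStep A B :=
  Relation.ReflTransGen.mono (fun _ _ h => h.2.2) _ _ h

theorem NNFDerives.isNNF {A B : Fml L} (h : NNFDerives A B) (hA : A.IsNNF) : B.IsNNF := by
  induction h with
  | refl => exact hA
  | tail _ h _ => exact h.2.1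

end NNFDerives

/-! ### Universal elimination relative to an existential prefix -/

section ScopedStep

/-- Universal quantifier elimination with a variable of an existential quantifier in the
formula. -/
inductive ScopeRule : Fml L → Fml L → Prop
  | mk {y : ℕ} {A B : Fml L} : Inst y A B → ScopeRule (ex y A) (ex y B)

/-- Universal quantifier elimination in a formula that lies in the scope of existential quantifiers
binding the variables in `V`. -/
def ScopedStep (V : Set ℕ) (A B : Fml L) : Prop :=
  (∃ y ∈ V, Inst y A B) ∨ InContext ScopeRule A B

/-- An elimination with `y` itself finds its existential quantifier here and becomes an inner step;
one with another variable still relies on a quantifier further out. -/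
theorem ScopedStep.ex {V W : Set ℕ} {y : ℕ} (hV : ∀ x ∈ V, x = y ∨ x ∈ W) {A B : Fml L} :
    ScopedStep V A B → ScopedStep W (ex y A) (ex y B)
  | .inl ⟨x, hx, h⟩ => by
    by_cases hxy : x = y
    · subst hxy
      exact .inr (.here (.mk h))
    · exact .inl ⟨x, (hV x hx).resolve_left hxy, .ex y (Ne.symm hxy) h⟩
  | .inr h => .inr (.ex y h)

/-- A universal quantifier supplies no witness, so the variables used have to come from outside and
must differ from the one it binds. -/
theorem ScopedStep.all {V W : Set ℕ} {y : ℕ} (hV : ∀ x ∈ V, y ≠ x ∧ x ∈ W) {A B : Fml L} :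
    ScopedStep V A B → ScopedStep W (all y A) (all y B)
  | .inl ⟨x, hx, h⟩ => .inl ⟨x, (hV x hx).2, .all y (hV x hx).1 h⟩
  | .inr h => .inr (.all y h)

theorem Inst.isNNF {y : ℕ} {A B : Fml L} (h : Inst y A B) (hA : A.IsNNF) : B.IsNNF := by
  induction h with
  | elim x A _ => exact isNNF_subst.2 hA
  | andL C _ ih => exact And.intro (ih hA.1) hA.2
  | andR C _ ih => exact And.intro hA.1 (ih hA.2)
  | orL C _ ih => exact And.intro (ih hA.1) hA.2
  | orR C _ ih => exact And.intro hA.1 (ih hA.2)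
  | all z _ _ ih => exact ih hA
  | ex z _ _ ih => exact ih hA

theorem Inst.occursIn {x y : ℕ} {A B : Fml L} (h : Inst y A B) (hB : B.OccursIn x) :
    x = y ∨ A.OccursIn x := by
  induction h with
  | elim z A _ => exact hB.of_subst.imp_right .inr
  | _ => simp only [OccursIn] at hB ⊢; tauto

theorem ScopeRule.isNNF {A B : Fml L} (h : InContext ScopeRule A B) (hA : A.IsNNF) :
    B.IsNNF := by
  induction h with
  | here h => cases h with | mk h => exact h.isNNF hA
  | @neg A B h _ =>
    cases A with
    | rel R ts => cases h with | here h => cases h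
    | _ => exact hA.elim
  | andL C _ ih => exact And.intro (ih hA.1) hA.2
  | andR C _ ih => exact And.intro hA.1 (ih hA.2)
  | orL C _ ih => exact And.intro (ih hA.1) hA.2
  | orR C _ ih => exact And.intro hA.1 (ih hA.2)
  | impL | impR | iffL | iffR => exact hA.elim
  | all z _ ih => exact ih hA
  | ex z _ ih => exact ih hA

theorem ScopeRule.occursIn {x : ℕ} {A B : Fml L} (h : InContext ScopeRule A B)
    (hB : B.OccursIn x) : A.OccursIn x := by
  induction h with
  | here h =>
    cases h with
    | mk h =>
      rcases hB with rfl | hB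
      · exact .inl rfl
      · exact (h.occursIn hB).imp_left Eq.symm
  | neg _ ih => exact ih hB
  | _ => simp only [OccursIn] at hB ⊢; tauto

theorem ScopeRule.inContext_allERule {A B : Fml L} (h : InContext ScopeRule A B) :
    InContext AllERule A B := by
  induction h with
  | here h => cases h with | mk h => exact .here (.scope h)
  | neg _ ih => exact .neg ih
  | andL C _ ih => exact .andL C ih
  | andR C _ ih => exact .andR C ih
  | orL C _ ih => exact .orL C ih
  | orR C _ ih => exact .orR C ih
  | impL C _ ih => exact .impL C ih
  | impR C _ ih => exact .impR C ih
  | iffL C _ ih => exact .iffL C ih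
  | iffR C _ ih => exact .iffR C ih
  | all x _ ih => exact .all x ih
  | ex x _ ih => exact .ex x ih

/-- Steps in the scope of a quantifier `∃ y` become applications of universal quantifier
elimination, the first elimination with `y` putting `∃ y` in front. -/
theorem allESteps_of_scopedSteps {V : Set ℕ} {y : ℕ} (hV : ∀ x ∈ V, x = y) {A B : Fml L}
    (hA : A.IsNNF) (hy : ¬ A.OccursIn y) (h : Relation.ReflTransGen (ScopedStep V) A B) :
    B.IsNNF ∧ ((Relation.ReflTransGen AllEStep A B ∧ ¬ B.OccursIn y) ∨
      Relation.ReflTransGen AllEStep A (ex y B)) := by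
  -- The disjunction records whether an elimination with `y` has taken place: before that `y` is new
  -- and `∃ y` is absent; afterwards `∃ y` stands in front and has everything in its scope.
  induction h with
  | refl => exact ⟨hA, .inl ⟨.refl, hy⟩⟩
  | @tail B C _ h ih =>
    obtain ⟨hB, ih⟩ := ih
    rcases h with ⟨x, hx, h⟩ | h
    · obtain rfl := hV x hx
      refine ⟨h.isNNF hB, .inr ?_⟩
      rcases ih with ⟨ih, hyB⟩ | ih
      · exact ih.tail ⟨hB, .here (.new hyB h)⟩
      · exact ih.tail ⟨hB, .here (.scope h)⟩
    · refine ⟨ScopeRule.isNNF h hB, ?_⟩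
      rcases ih with ⟨ih, hyB⟩ | ih
      · exact .inl ⟨ih.tail ⟨hB, ScopeRule.inContext_allERule h⟩,
          fun hC => hyB (ScopeRule.occursIn h hC)⟩
      · exact .inr (ih.tail ⟨hB, .ex y (ScopeRule.inContext_allERule h)⟩)

/-- Replace all universally quantified variables with `z`, from the inside to the outside. -/
def Fml.elimAll (z : ℕ) : Fml L → Fml L
  | and A B => and (A.elimAll z) (B.elimAll z)
  | or A B => or (A.elimAll z) (B.elimAll z)
  | all x A => (A.elimAll z).subst x z
  | ex x A => ex x (A.elimAll z)
  | A => A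

theorem Fml.elimAll_of_quantFree {z : ℕ} {A : Fml L} (h : A.QuantFree) : A.elimAll z = A := by
  induction A with
  | and A B ihA ihB => simp only [elimAll, ihA h.1, ihB h.2]
  | or A B ihA ihB => simp only [elimAll, ihA h.1, ihB h.2]
  | all | ex => exact h.elim
  | _ => rfl

theorem Fml.noAll_elimAll {z : ℕ} {A : Fml L} (h : A.IsNNF) : (A.elimAll z).NoAll := by
  induction A with
  | and A B ihA ihB => exact And.intro (ihA h.1) (ihB h.2)
  | or A B ihA ihB => exact And.intro (ihA h.1) (ihB h.2)
  | all x A ih => exact noAll_subst.2 (ih h)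
  | ex x A ih => exact ih h
  | rel R ts => trivial
  | neg A =>
    cases A with
    | rel R ts => trivial
    | _ => exact h.elim
  | imp | iff => exact h.elim

theorem Fml.BoundIn.of_elimAll {x z : ℕ} {A : Fml L} (h : (A.elimAll z).BoundIn x) :
    A.BoundIn x := by
  induction A with
  | and A B ihA ihB => exact h.imp ihA ihB
  | or A B ihA ihB => exact h.imp ihA ihB
  | all y A ih => exact .inr (ih (boundIn_subst.1 h))
  | ex y A ih => exact h.imp_right ih
  | _ => exact h

/-- Inner quantifiers go first. The copies of `z` that this produces are free, so `z` remains free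
for every variable replaced later. -/
theorem inst_elimAll {z : ℕ} {A : Fml L} (h : ¬ A.BoundIn z) :
    Relation.ReflTransGen (Inst z) A (A.elimAll z) := by
  induction A with
  | and A B ihA ihB =>
    exact ((ihA fun hz => h (.inl hz)).lift (fun A => and A B) fun _ _ h => .andL B h).trans
      ((ihB fun hz => h (.inr hz)).lift (fun B => Fml.and _ B) fun _ _ h => .andR _ h)
  | or A B ihA ihB =>
    exact ((ihA fun hz => h (.inl hz)).lift (fun A => Fml.or A B) fun _ _ h => .orL B h).trans
      ((ihB fun hz => h (.inr hz)).lift (fun B => Fml.or _ B) fun _ _ h => .orR _ h)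
  | all x A ih =>
    exact .tail ((ih fun hz => h (.inr hz)).lift (fun A => Fml.all x A)
      fun _ _ h' => .all x (fun hx => h (.inl hx)) h')
      (.elim x _ (freeFor_of_not_boundIn fun hz => h (.inr hz.of_elimAll)))
  | ex x A ih =>
    exact (ih fun hz => h (.inr hz)).lift (fun A => Fml.ex x A)
      fun _ _ h' => .ex x (fun hx => h (.inl hx)) h'
  | _ => exact .refl

end ScopedStep

/-! ### The Herbrand expansion and its derivation -/

section Expansion

namespace Fml

/-- `a`, `b` or `c`, according to whether the formula begins with a universal quantifier, begins
with an existential quantifier, or is not a quantification. -/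
def quantCases {α : Sort*} (A : Fml L) (a b c : α) : α :=
  match A with
  | all _ _ => a
  | ex _ _ => b
  | _ => c

/-- Delete the first quantifier and replace the occurrences that it binds with `y`. -/
def body (y : ℕ) : Fml L → Fml L
  | all x A => A.subst x y
  | ex x A => A.subst x y
  | A => A

end Fml

variable (P : Fml L) (N : ℕ)

/-- An enumeration of the instances of the prenex sentence `P` in its Herbrand expansion: the
instance number `k + 1` results from the instance with number `k.unpair.1` (from `P`, if that one is
quantifier-free) by replacing the first quantified variable with the new variable `N + (k + 1)`. -/
def expansion : ℕ → Fml L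
  | 0 => P
  | k + 1 =>
    ((expansion k.unpair.1).quantCases (expansion k.unpair.1) (expansion k.unpair.1) P).body
      (N + (k + 1))
termination_by k => k
decreasing_by exact Nat.lt_succ_of_le (Nat.unpair_left_le k)

/-- The formula whose instance is `expansion P N (k + 1)`. -/
def source (k : ℕ) : Fml L :=
  (expansion P N k.unpair.1).quantCases (expansion P N k.unpair.1) (expansion P N k.unpair.1) P

theorem expansion_zero : expansion P N 0 = P := by rw [expansion]

theorem expansion_succ (k : ℕ) :
    expansion P N (k + 1) = (source P N k).body (N + (k + 1)) := by
  rw [expansion, source]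

/-- `N + witness P N k` is the variable that interprets the variable `N + k`: itself, if it comes
from an existential quantifier, and the variable interpreting `N + k.unpair.2` if it replaces a
universally quantified one. -/
def witness : ℕ → ℕ
  | 0 => 0
  | k + 1 => (source P N k).quantCases (witness k.unpair.2) (k + 1) (k + 1)
termination_by k => k
decreasing_by exact Nat.lt_succ_of_le (Nat.unpair_right_le k)

theorem witness_zero : witness P N 0 = 0 := by rw [witness]

variable {P N}

theorem witness_succ_of_all {k x : ℕ} {A : Fml L} (h : source P N k = all x A) :
    witness P N (k + 1) = witness P N k.unpair.2 := by rw [witness, h, quantCases]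

theorem witness_succ_of_ex {k x : ℕ} {A : Fml L} (h : source P N k = ex x A) :
    witness P N (k + 1) = k + 1 := by rw [witness, h, quantCases]

theorem witness_le (k : ℕ) : witness P N k ≤ k := by
  induction k using Nat.strong_induction_on with
  | _ k ih =>
    cases k with
    | zero => rw [witness_zero]
    | succ k =>
      rw [witness]
      unfold quantCases
      split
      · have := Nat.unpair_right_le k
        have := ih k.unpair.2 (by omega)
        omega
      · exact le_rfl
      · exact le_rfl

/-- The assumptions on a sentence whose Herbrand expansion is considered. -/
structure IsBase (P : Fml L) (N : ℕ) : Prop where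
  isPrenex : ∃ n, IsPrenex (n + 1) P
  isNNF : P.IsNNF
  isSentence : P.IsSentence
  lt_of_occursIn : ∀ x, P.OccursIn x → x < N

/-- Where the chosen instance has no quantifier left, `P` takes its place, and `P` has at least one
quantifier. So no step of the enumeration is idle. -/
theorem IsBase.source_cases (h : IsBase P N) (k : ℕ) :
    (∃ x A, source P N k = all x A) ∨ ∃ x A, source P N k = ex x A := by
  unfold source quantCases
  split
  · exact .inl ⟨_, _, ‹_›⟩
  · exact .inr ⟨_, _, ‹_›⟩
  · obtain ⟨n, hn⟩ := h.isPrenex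
    cases hn with
    | all => exact .inl ⟨_, _, rfl⟩
    | ex => exact .inr ⟨_, _, rfl⟩

theorem exists_source_eq (k : ℕ) : ∃ i ≤ k, source P N k = expansion P N i := by
  unfold source quantCases
  split
  · exact ⟨_, Nat.unpair_left_le k, rfl⟩
  · exact ⟨_, Nat.unpair_left_le k, rfl⟩
  · exact ⟨0, Nat.zero_le k, (expansion_zero P N).symm⟩

/-- The invariants of the Herbrand expansion. -/
theorem IsBase.expansion_spec (h : IsBase P N) (k : ℕ) :
    (∃ n, IsPrenex n (expansion P N k)) ∧ (expansion P N k).IsNNF ∧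
      (∀ x, (expansion P N k).BoundIn x → x < N) ∧
      (∀ x, (expansion P N k).FreeIn x → N < x) ∧
      ∀ x, (expansion P N k).OccursIn x → x < N ∨ N < x ∧ x ≤ N + k := by
  induction k using Nat.strong_induction_on with
  | _ k ih =>
    cases k with
    | zero =>
      rw [expansion_zero]
      obtain ⟨n, hn⟩ := h.isPrenex
      exact ⟨⟨_, hn⟩, h.isNNF, fun x hx => h.lt_of_occursIn x hx.occursIn,
        fun x hx => (h.isSentence x hx).elim, fun x hx => .inl (h.lt_of_occursIn x hx)⟩
    | succ k =>
      obtain ⟨i, hi, hs⟩ := exists_source_eq (P := P) (N := N) k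
      obtain ⟨⟨n, hn⟩, h1, h2, h3, h4⟩ := ih i (by omega)
      rw [← hs] at hn h1 h2 h3 h4
      rw [expansion_succ]
      obtain ⟨x, A, hA⟩ | ⟨x, A, hA⟩ := h.source_cases k
      all_goals
        rw [hA] at hn h1 h2 h3 h4
        have hf : A.FreeFor x (N + (k + 1)) := freeFor_of_not_boundIn fun hb =>
          absurd (h2 _ (.inr hb)) (by omega)
        rw [hA, body]
        refine ⟨?_, isNNF_subst.2 h1, fun y hy => h2 y (.inr (boundIn_subst.1 hy)),
          fun y hy => ?_, fun y hy => ?_⟩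
        · cases hn with
          | qf hq => exact hq.elim
          | _ => exact ⟨_, IsPrenex.subst ‹_› _ _⟩
        · rcases (freeIn_subst hf).1 hy with ⟨hyx, hy⟩ | ⟨rfl, -⟩
          · exact h3 y ⟨Ne.symm hyx, hy⟩
          · omega
        · rcases hy.of_subst with rfl | hy
          · omega
          · have := h4 y (.inr hy)
            omega

theorem IsBase.not_occursIn_source (h : IsBase P N) (k : ℕ) :
    ¬ (source P N k).OccursIn (N + (k + 1)) := by
  obtain ⟨i, hi, hs⟩ := exists_source_eq (P := P) (N := N) k
  intro ho
  have := (h.expansion_spec i).2.2.2.2 _ (hs ▸ ho)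
  omega

/-- Following universal variables back ends at an existential variable or at `0`, and both are
fixed. Hence the values of `witness` can serve as the domain of a model. -/
theorem IsBase.witness_witness (h : IsBase P N) (k : ℕ) :
    witness P N (witness P N k) = witness P N k := by
  induction k using Nat.strong_induction_on with
  | _ k ih =>
    cases k with
    | zero => simp only [witness_zero]
    | succ k =>
      obtain ⟨x, A, hA⟩ | ⟨x, A, hA⟩ := h.source_cases k
      · rw [witness_succ_of_all hA, ih _ (Nat.lt_succ_of_le (Nat.unpair_right_le k))]
      · simp only [witness_succ_of_ex hA]

/-- The conjunction of the instances with numbers up to `k`. -/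
def conjunction (P : Fml L) (N : ℕ) : ℕ → Fml L
  | 0 => P
  | k + 1 => and (expansion P N (k + 1)) (conjunction P N k)

theorem IsBase.isNNF_conjunction (h : IsBase P N) (k : ℕ) : (conjunction P N k).IsNNF := by
  induction k with
  | zero => exact h.isNNF
  | succ k ih => exact And.intro (h.expansion_spec (k + 1)).2.1 ih

theorem IsBase.boundIn_conjunction (h : IsBase P N) (k : ℕ) {x : ℕ}
    (hx : (conjunction P N k).BoundIn x) : x < N := by
  induction k with
  | zero => exact h.lt_of_occursIn x hx.occursIn
  | succ k ih => exact hx.elim ((h.expansion_spec (k + 1)).2.2.1 x) ih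

theorem IsBase.occursIn_conjunction (h : IsBase P N) (k : ℕ) {x : ℕ}
    (hx : (conjunction P N k).OccursIn x) : x < N ∨ N < x ∧ x ≤ N + k := by
  induction k with
  | zero => exact .inl (h.lt_of_occursIn x hx)
  | succ k ih =>
    rcases hx with hx | hx
    · exact (h.expansion_spec (k + 1)).2.2.2.2 x hx
    · have := ih hx
      omega

/-- Multiplication of a conjunct. -/
theorem IsBase.conjunction_nnfDerives (h : IsBase P N) {i k : ℕ} (hi : i ≤ k) :
    NNFDerives (conjunction P N k) (and (expansion P N i) (conjunction P N k)) := by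
  induction k with
  | zero =>
    obtain rfl : i = 0 := by omega
    rw [expansion_zero]
    exact .rule (.andI P) h.isNNF (And.intro h.isNNF h.isNNF)
  | succ k ih =>
    have hA := (h.expansion_spec (k + 1)).2.1
    have hC := h.isNNF_conjunction k
    have hB := (h.expansion_spec i).2.1
    rcases hi.lt_or_eq with hi | rfl
    -- The copy made among the older conjuncts is moved to the front, past the newest one.
    · refine ((ih (by omega)).andR hA).trans ?_
      refine (NNFDerives.rule_symm (.lattice (.andAssoc _ _ _))
        (And.intro (And.intro hA hB) hC) (And.intro hA (And.intro hB hC))).trans ?_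
      refine (NNFDerives.andL hC (.rule (.lattice (.andComm _ _)) (And.intro hA hB)
        (And.intro hB hA))).trans ?_
      exact NNFDerives.rule (.lattice (.andAssoc _ _ _)) (And.intro (And.intro hB hA) hC)
        (And.intro hB (And.intro hA hC))
    · exact (NNFDerives.andL hC (.rule (.andI _) hA (And.intro hA hA))).trans
        (NNFDerives.rule (.lattice (.andAssoc _ _ _)) (And.intro (And.intro hA hA) hC)
          (And.intro hA (And.intro hA hC)))

/-- `B` with the quantifiers belonging to the instances with numbers `1, …, k` in front. -/
def prefixed (P : Fml L) (N : ℕ) : ℕ → Fml L → Fml L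
  | 0, B => B
  | k + 1, B => prefixed P N k
    ((source P N k).quantCases (all (N + (k + 1)) B) (ex (N + (k + 1)) B) B)

theorem prefixed_nnfDerives {A B : Fml L} (k : ℕ) (hAB : NNFDerives A B) :
    NNFDerives (prefixed P N k A) (prefixed P N k B) := by
  induction k generalizing A B with
  | zero => exact hAB
  | succ k ih =>
    refine ih ?_
    unfold quantCases
    split
    exacts [hAB.all _, hAB.ex _, hAB]

/-- A stage multiplies the conjunct `source P N k`, renames its leading quantifier to the fresh
variable `N + (k + 1)` and pulls it out over the conjunction. It lands at the inner end of the
prefix, in the scope of all earlier quantifiers. -/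
theorem IsBase.nnfDerives_prefixed (h : IsBase P N) (k : ℕ) :
    NNFDerives P (prefixed P N k (conjunction P N k)) := by
  induction k with
  | zero => exact .refl
  | succ k ih =>
    refine ih.trans (prefixed_nnfDerives k ?_)
    obtain ⟨i, hi, hs⟩ := exists_source_eq (P := P) (N := N) k
    have hC := h.isNNF_conjunction k
    have hS : (source P N k).IsNNF := hs ▸ (h.expansion_spec i).2.1
    have ho := h.not_occursIn_source k
    have hCo : ¬ (conjunction P N k).FreeIn (N + (k + 1)) := fun hf => by
      have := h.occursIn_conjunction k hf.occursIn
      omega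
    refine (h.conjunction_nnfDerives hi).trans ?_
    rw [← hs, conjunction, expansion_succ]
    obtain ⟨x, A, hA⟩ | ⟨x, A, hA⟩ := h.source_cases k
    all_goals
      rw [hA] at hS ho ⊢
      have hS' : (A.subst x (N + (k + 1))).IsNNF := isNNF_subst.2 hS
      rw [quantCases, body]
    · refine (NNFDerives.andL hC (.rule (.sub (.sub2 x _ A fun h => ho (.inr h))) hS hS')).trans ?_
      exact NNFDerives.rule_symm (.pn (.pn2 _ _ _ hCo)) (And.intro hS' hC) (And.intro hS' hC)
    · refine (NNFDerives.andL hC (.rule (.sub (.sub1 x _ A fun h => ho (.inr h))) hS hS')).trans ?_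
      exact NNFDerives.rule_symm (.pn (.pn6 _ _ _ hCo)) (And.intro hS' hC) (And.intro hS' hC)

theorem not_occursIn_prefixed {k : ℕ} {B : Fml L} (hB : ¬ B.OccursIn N) :
    ¬ (prefixed P N k B).OccursIn N := by
  induction k generalizing B with
  | zero => exact hB
  | succ k ih =>
    refine ih ?_
    have : ¬ (N + (k + 1) = N ∨ B.OccursIn N) := by
      rintro (h | h)
      exacts [by omega, hB h]
    unfold quantCases
    split
    exacts [this, this, hB]

/-- The result of eliminating the universal quantifiers of the prefix of `prefixed P N k B`. -/
def instantiated (P : Fml L) (N : ℕ) : ℕ → Fml L → Fml L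
  | 0, B => B
  | k + 1, B => instantiated P N k ((source P N k).quantCases
      (B.subst (N + (k + 1)) (N + witness P N (k + 1))) (ex (N + (k + 1)) B) B)

theorem noAll_instantiated {k : ℕ} {B : Fml L} (hB : B.NoAll) :
    (instantiated P N k B).NoAll := by
  induction k generalizing B with
  | zero => exact hB
  | succ k ih =>
    refine ih ?_
    unfold quantCases
    split
    exacts [noAll_subst.2 hB, hB, hB]

/-- The variables that interpret the variables `N, …, N + k`. -/
def witnesses (P : Fml L) (N k : ℕ) : Set ℕ := {y | ∃ j ≤ k, y = N + witness P N j}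

/-- The prefix is added from the inside outwards. An existential quantifier supplies its own
variable; a universal one is passed because its variable is no witness. In the end only `N` has to
be supplied from outside. -/
theorem IsBase.prefixed_scopedSteps (h : IsBase P N) {k : ℕ} {A B : Fml L}
    (hAB : Relation.ReflTransGen (ScopedStep (witnesses P N k)) A B) :
    Relation.ReflTransGen (ScopedStep (witnesses P N 0)) (prefixed P N k A)
      (prefixed P N k B) := by
  induction k generalizing A B with
  | zero => exact hAB
  | succ k ih =>
    refine ih ?_
    obtain ⟨x, C, hC⟩ | ⟨x, C, hC⟩ := h.source_cases k
    · simp only [hC, quantCases]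
      refine hAB.lift (fun A => Fml.all _ A) fun A B hAB => hAB.all ?_
      -- A universal variable contributes no new witness, and the witnesses of indices up to `k` lie
      -- below `N + (k + 1)`.
      suffices ∃ j ≤ k, witness P N (k + 1) = witness P N j by
        rintro _ ⟨j, hj, rfl⟩
        obtain ⟨i, hi, hji⟩ : ∃ i ≤ k, witness P N j = witness P N i := by
          rcases hj.lt_or_eq with hj | rfl
          exacts [⟨j, by omega, rfl⟩, this]
        have := witness_le (P := P) (N := N) i
        exact ⟨by omega, i, hi, by rw [hji]⟩
      exact ⟨_, Nat.unpair_right_le k, witness_succ_of_all hC⟩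
    · simp only [hC, quantCases]
      refine hAB.lift (fun A => Fml.ex _ A) fun A B hAB => hAB.ex ?_
      rintro _ ⟨j, hj, rfl⟩
      rcases hj.lt_or_eq with hj | rfl
      · exact .inr ⟨j, by omega, rfl⟩
      · exact .inl (by rw [witness_succ_of_ex hC])

/-- The witness of a universal variable lies between `N` and `N + k`, a range that the bound
variables of `B` avoid. -/
theorem freeFor_witness {k x : ℕ} {A B : Fml L} (hA : source P N k = all x A)
    (hB : ∀ x, B.BoundIn x → x < N ∨ N + (k + 1) < x) :
    B.FreeFor (N + (k + 1)) (N + witness P N (k + 1)) := by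
  refine freeFor_of_not_boundIn fun hb => ?_
  have hw := (witness_le (P := P) (N := N) _).trans (Nat.unpair_right_le k)
  rw [witness_succ_of_all hA] at hb
  have := hB _ hb
  omega

/-- Universal quantifiers are removed from the inside outwards. When `N + (k + 1)` has its turn, the
prefix outside it is intact, so its witness is either bound by an existential quantifier there or is
`N`. -/
theorem IsBase.scopedSteps_instantiated (h : IsBase P N) {k : ℕ} {B : Fml L}
    (hB : ∀ x, B.BoundIn x → x < N ∨ N + k < x) :
    Relation.ReflTransGen (ScopedStep (witnesses P N 0)) (prefixed P N k B)
      (instantiated P N k B) := by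
  induction k generalizing B with
  | zero => exact .refl
  | succ k ih =>
    simp only [prefixed, instantiated]
    obtain ⟨x, C, hC⟩ | ⟨x, C, hC⟩ := h.source_cases k
    · simp only [hC, quantCases]
      refine .trans (h.prefixed_scopedSteps (.single (.inl ⟨N + witness P N (k + 1),
        ⟨_, Nat.unpair_right_le k, by rw [witness_succ_of_all hC]⟩,
        .elim _ B (freeFor_witness hC hB)⟩))) (ih fun y hy => ?_)
      have := hB y (boundIn_subst.1 hy)
      omega
    · simp only [hC, quantCases]
      refine ih fun y hy => ?_
      rcases hy with rfl | hy
      · omega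
      · have := hB y hy
        omega

/-- Undoing the instantiation from the outside inwards, an existential variable takes the value that
makes its formula true, and a universal variable takes the value of its witness. -/
theorem IsBase.exists_realize_of_instantiated (h : IsBase P N) {M : Type w} [L.Structure M]
    {k : ℕ} {B : Fml L} {s : ℕ → M} (hB : ∀ x, B.BoundIn x → x < N ∨ N + k < x)
    (hs : (instantiated P N k B).Realize s) :
    ∃ t : ℕ → M, B.Realize t ∧ ∀ j ≤ k, t (N + j) = t (N + witness P N j) := by
  induction k generalizing B with
  | zero => exact ⟨s, hs, fun j hj => by
      obtain rfl : j = 0 := by omega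
      rw [witness_zero]⟩
  | succ k ih =>
    -- The bound on the witness singles out the universal case: an existential variable has witness
    -- `k + 1`, and nothing is required of `a`.
    obtain ⟨t, ⟨a, ha, hk⟩, hj⟩ : ∃ t : ℕ → M,
        (∃ a, B.Realize (Function.update t (N + (k + 1)) a) ∧
        (witness P N (k + 1) ≤ k → a = t (N + witness P N (k + 1)))) ∧
        ∀ j ≤ k, t (N + j) = t (N + witness P N j) := by
      simp only [instantiated] at hs
      obtain ⟨x, C, hC⟩ | ⟨x, C, hC⟩ := h.source_cases k
      · simp only [hC, quantCases] at hs
        obtain ⟨t, ht, hj⟩ := ih (fun y hy => by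
          have := hB y (boundIn_subst.1 hy)
          omega) hs
        exact ⟨t, ⟨_, (realize_subst (freeFor_witness hC hB) t).1 ht, fun _ => rfl⟩, hj⟩
      · simp only [hC, quantCases] at hs
        obtain ⟨t, ⟨a, ha⟩, hj⟩ := ih (fun y hy => by
          rcases hy with rfl | hy
          · omega
          · have := hB y hy
            omega) hs
        exact ⟨t, ⟨a, ha, fun hw => by rw [witness_succ_of_ex hC] at hw; omega⟩, hj⟩
    refine ⟨_, ha, fun j hjk => ?_⟩
    have := witness_le (P := P) (N := N) j
    rcases hjk.lt_or_eq with hjk | rfl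
    · rw [Function.update_of_ne (by omega), Function.update_of_ne (by omega), hj j (by omega)]
    · by_cases hw : witness P N (k + 1) ≤ k
      · rw [Function.update_self, Function.update_of_ne (by omega), hk hw]
      · rw [show witness P N (k + 1) = k + 1 by omega]

end Expansion

/-! ### A model from satisfiable finite parts -/

section Completeness

variable {P : Fml L} {N : ℕ}

/-- Łoś's theorem for quantifier-free formulas. -/
theorem Fml.QuantFree.realize_iff_eventually {ι : Type*} (U : Ultrafilter ι) {M : ι → Type w}
    [∀ i, L.Structure (M i)] {T : Type*} [L.Structure T] {s : ∀ i, ℕ → M i} {t : ℕ → T}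
    {p : ℕ → Prop}
    (hrel : ∀ (n : ℕ) (R : L.Relations n) (ts : Fin n → ℕ), (∀ i, p (ts i)) →
      ((rel R ts).Realize t ↔ ∀ᶠ i in (U : Filter ι), (rel R ts).Realize (s i)))
    {A : Fml L} (hA : A.QuantFree) (hp : ∀ x, A.FreeIn x → p x) :
    A.Realize t ↔ ∀ᶠ i in (U : Filter ι), A.Realize (s i) := by
  induction A with
  | rel R ts => exact hrel _ R ts fun i => hp _ ⟨i, rfl⟩
  | neg A ih => simp only [Realize, ih hA hp, Ultrafilter.eventually_not]
  | and A B ihA ihB =>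
    simp only [Realize, ihA hA.1 fun x hx => hp x (.inl hx), ihB hA.2 fun x hx => hp x (.inr hx),
      Filter.eventually_and]
  | or A B ihA ihB =>
    simp only [Realize, ihA hA.1 fun x hx => hp x (.inl hx), ihB hA.2 fun x hx => hp x (.inr hx),
      Ultrafilter.eventually_or]
  | imp A B ihA ihB =>
    simp only [Realize, ihA hA.1 fun x hx => hp x (.inl hx), ihB hA.2 fun x hx => hp x (.inr hx),
      Ultrafilter.eventually_imp]
  | iff A B ihA ihB =>
    simp only [Realize, ihA hA.1 fun x hx => hp x (.inl hx), ihB hA.2 fun x hx => hp x (.inr hx),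
      iff_def, Filter.eventually_and, Ultrafilter.eventually_imp]
  | all | ex => exact hA.elim

/-- If all quantifier-free instances in the Herbrand expansion are true in a structure whose
elements are the values of the variables `N + k`, then `P` is true. -/
theorem IsBase.realize_of_quantFree (h : IsBase P N) {T : Type w} [L.Structure T] {t : ℕ → T}
    (hw : ∀ k, t (N + witness P N k) = t (N + k)) (hsurj : ∀ a, ∃ k, t (N + k) = a)
    (hqf : ∀ k, (expansion P N k).QuantFree →
      (expansion P N k).Realize t) : P.Realize t := by
  -- All instances are treated at once, by induction on the number of quantifiers left; `P` is the
  -- instance with number `0`.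
  suffices ∀ n k, IsPrenex n (expansion P N k) →
      (expansion P N k).Realize t by
    obtain ⟨n, hn⟩ := (h.expansion_spec 0).1
    simpa only [expansion_zero] using this n 0 hn
  intro n
  induction n with
  | zero =>
    intro k hk
    cases hk with
    | qf hk => exact hqf k hk
  | succ n ih =>
    intro j hj
    have key : ∀ (v x : ℕ) (A : Fml L), IsPrenex n A →
        source P N (Nat.pair j v) = expansion P N j →
        (expansion P N j = all x A ∨ expansion P N j = ex x A) →
        A.Realize (Function.update t x (t (N + (Nat.pair j v + 1)))) := by
      intro v x A hA hs hx
      have hb : A.FreeFor x (N + (Nat.pair j v + 1)) := freeFor_of_not_boundIn fun hb => by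
        have : N + (Nat.pair j v + 1) < N := (h.expansion_spec j).2.2.1 _ (by
          rcases hx with hx | hx <;> rw [hx] <;> exact .inr hb)
        omega
      have he : expansion P N (Nat.pair j v + 1) =
          A.subst x (N + (Nat.pair j v + 1)) := by
        rw [expansion_succ, hs]
        rcases hx with hx | hx <;> rw [hx, body]
      rw [← realize_subst hb, ← he]
      exact ih _ (he ▸ hA.subst _ _)
    generalize hE : expansion P N j = E at *
    cases hj with
    | @all _ x A hA =>
      intro a
      -- The instance made from `j` and `v` settles this element: its new variable has the same
      -- witness as `N + v`, hence the same value.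
      obtain ⟨v, rfl⟩ := hsurj a
      have hs : source P N (Nat.pair j v) = all x A := by
        rw [source, Nat.unpair_pair, hE, quantCases]
      have := key v x A hA hs (.inl rfl)
      rwa [← hw, witness_succ_of_all hs, Nat.unpair_pair, hw] at this
    | @ex _ x A hA =>
      have hs : source P N (Nat.pair j 0) = ex x A := by
        rw [source, Nat.unpair_pair, hE, quantCases]
      -- For an existential quantifier the second component of the pair plays no role, so `0` will
      -- do.
      exact ⟨_, key 0 x A hA hs (.inr rfl)⟩

/-- If every finite part of the Herbrand expansion is satisfiable, then so is `P`. -/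
theorem IsBase.exists_realize (h : IsBase P N)
    (hsat : ∀ K, ∃ (M : Type w) (_ : L.Structure M) (s : ℕ → M),
      (∀ j ≤ K, (expansion P N j).QuantFree →
        (expansion P N j).Realize s) ∧
      ∀ j ≤ K, s (N + j) = s (N + witness P N j)) :
    ∃ (T : Type w) (_ : Nonempty T) (_ : L.Structure T) (t : ℕ → T), P.Realize t := by
  choose M _ s hs hsw using hsat
  let U : Ultrafilter ℕ := Filter.hyperfilter ℕ
  have hU : ∀ k, ∀ᶠ K in (U : Filter ℕ), k ≤ K := fun k =>
    Nat.hyperfilter_le_atTop (Filter.eventually_ge_atTop k)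
  -- The elements are the witnesses themselves, and an atom holds if it holds in almost all of the
  -- given models. In the absence of identity no quotient is needed.
  let T := ULift.{w} (Set.range (witness P N))
  let t : ℕ → T := fun n => ⟨_, n - N, rfl⟩
  let _ : L.Structure T :=
    { funMap := fun _ _ => t 0
      RelMap := fun R a => ∀ᶠ K in (U : Filter ℕ),
        FirstOrder.Language.Structure.RelMap R fun i => s K (N + (a i).down.1) }
  have htN : ∀ k, t (N + k) = ⟨witness P N k, k, rfl⟩ := fun k => by
    simp only [t, Nat.add_sub_cancel_left]
  refine ⟨T, ⟨t 0⟩, inferInstance, t, h.realize_of_quantFree (fun k => ?_) ?_ fun k hk => ?_⟩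
  · simp only [htN, h.witness_witness]
  · rintro ⟨_, k, rfl⟩
    exact ⟨k, htN k⟩
  · refine (hk.realize_iff_eventually U (s := s) (p := fun x => N ≤ x) (fun n R ts hN => ?_)
      fun x hx => ((h.expansion_spec k).2.2.2.1 x hx).le).2 ((hU k).mono fun K hK => hs K k hK hk)
    refine Filter.eventually_congr ?_
    -- An atom has finitely many arguments, so almost every model is late enough to give each
    -- argument the value of its witness.
    have : ∀ᶠ K in (U : Filter ℕ), ∀ i, ts i - N ≤ K :=
      Filter.eventually_all.2 fun i => hU _
    refine this.mono fun K hK => iff_of_eq (congrArg _ (funext fun i => ?_))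
    rw [← hsw K _ (hK i), Nat.add_sub_cancel' (hN i)]

end Completeness

/-! ### Completeness -/

section Completeness

variable {P : Fml L} {N : ℕ}

/-- Instantiation with `N` leaves quantifier-free conjuncts unchanged, and only these are needed for
the model. -/
theorem realize_expansion_of_conjunction {M : Type w} [L.Structure M] {k : ℕ} {s : ℕ → M}
    (hs : ((conjunction P N k).elimAll N).Realize s) {j : ℕ} (hj : j ≤ k)
    (hq : (expansion P N j).QuantFree) : (expansion P N j).Realize s := by
  induction k with
  | zero =>
    obtain rfl : j = 0 := by omega
    rw [expansion_zero] at hq ⊢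
    rwa [← elimAll_of_quantFree hq (z := N)]
  | succ k ih =>
    rcases hj.lt_or_eq with hj | rfl
    · exact ih hs.2 (by omega)
    · rw [← elimAll_of_quantFree hq (z := N)]
      exact hs.1

theorem IsBase.refutableWithinNNF (h : IsBase P N) (hc : Contradictory.{u, v, w} P) :
    RefutableWithinNNF P := by
  obtain ⟨K, hK⟩ : ∃ K, Contradictory.{u, v, w}
      (instantiated P N K ((conjunction P N K).elimAll N)) := by
    -- If no stage is contradictory, the models of the stages combine into a model of `P`.
    by_contra hK
    simp only [Contradictory, not_exists, not_forall, not_not] at hK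
    obtain ⟨T, _, _, t, ht⟩ := h.exists_realize fun K => by
      obtain ⟨M, _, _, s, hs⟩ := hK K
      obtain ⟨t, ht, htw⟩ := h.exists_realize_of_instantiated
        (fun x hx => .inl (h.boundIn_conjunction K hx.of_elimAll)) hs
      exact ⟨M, _, t, fun j hj => realize_expansion_of_conjunction ht hj, htw⟩
    exact hc T t ht
  have hC := h.nnfDerives_prefixed K
  have hNb : ¬ (conjunction P N K).BoundIn N := fun hb => (h.boundIn_conjunction K hb).false
  have hNo : ¬ (conjunction P N K).OccursIn N := fun ho => by
    have := h.occursIn_conjunction K ho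
    omega
  -- The universal quantifiers of the matrix are eliminated first, with `N`; those of the prefix
  -- follow, with their witnesses.
  have hsteps := (h.prefixed_scopedSteps (Relation.ReflTransGen.mono
    (fun _ _ hi => .inl ⟨N, ⟨0, Nat.zero_le K, by rw [witness_zero, Nat.add_zero]⟩, hi⟩) _ _
      (inst_elimAll hNb))).trans
    (h.scopedSteps_instantiated fun x hx => .inl (h.boundIn_conjunction K hx.of_elimAll))
  obtain ⟨hn, hB⟩ := allESteps_of_scopedSteps (y := N) (by
    rintro _ ⟨j, hj, rfl⟩
    obtain rfl : j = 0 := by omega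
    rw [witness_zero, Nat.add_zero]) (hC.isNNF h.isNNF) (not_occursIn_prefixed hNo) hsteps
  have ha : (instantiated P N K ((conjunction P N K).elimAll N)).NoAll :=
    noAll_instantiated (noAll_elimAll (h.isNNF_conjunction K))
  rcases hB with ⟨hB, -⟩ | hB
  · exact ⟨_, _, hC, hB, isExplicitContradiction_of_contradictory.{u, v, w} hn ha hK⟩
  · refine ⟨_, _, hC, hB, isExplicitContradiction_of_contradictory.{u, v, w} (B := ex N _) hn ha ?_⟩
    exact fun M _ _ s hs => hs.elim fun a => hK M _

theorem Fml.Contradictory.refutableWithinNNF {A : Fml L} (hs : A.IsSentence) (hn : A.IsNNF)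
    (hc : Contradictory.{u, v, w} A) : RefutableWithinNNF A := by
  obtain ⟨n, P, hP, hAP⟩ := hn.exists_isPrenex
  have hPn := hAP.isNNF_iff.1 hn
  have hPc : Contradictory.{u, v, w} P := fun M _ _ s h => hc M s ((hAP.realize_iff s).2 h)
  have hAP' := hAP.nnfDerives hn
  suffices RefutableWithinNNF P by
    obtain ⟨C, B, hC, hB⟩ := this
    exact ⟨C, B, hAP'.trans hC, hB⟩
  rcases n with _ | n
  -- Without quantifiers there is nothing to expand: `P` is already an explicit contradiction.
  · obtain ⟨hq⟩ := hP
    have ha : P.NoAll := elimAll_of_quantFree (z := 0) hq ▸ noAll_elimAll hPn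
    exact ⟨P, P, .refl, .refl, isExplicitContradiction_of_contradictory hPn ha hPc⟩
  · obtain ⟨N, hN⟩ := exists_bound P
    exact IsBase.refutableWithinNNF ⟨⟨n, hP⟩, hPn, hs.of_equivSteps hAP'.equivSteps, hN⟩ hPc

theorem Fml.Contradictory.refutable {A : Fml L} (hs : A.IsSentence)
    (hc : Contradictory.{u, v, w} A) : Refutable A := by
  obtain ⟨C, hC, hAC⟩ := (hasNNF_and_hasNNF_neg A).1
  have hd : Derives A C := Relation.ReflTransGen.mono (fun _ _ h => Or.inl h) _ _ hAC
  have hCc : Contradictory.{u, v, w} C := by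
    intro M _ _ s h
    refine hc M s ?_
    clear hd hC hs
    induction hAC with
    | refl => exact h
    | tail _ hstep ih => exact ih ((hstep.realize_iff s).2 h)
  obtain ⟨B, hB, hBc⟩ := (hCc.refutableWithinNNF (hs.of_equivSteps hAC) hC).refutable
  exact ⟨B, hd.trans hB, hBc⟩

end Completeness

end NNFCalculus

theorem mainTheorem4 (L : FirstOrder.Language.{u, v}) [L.IsRelational] :
    (∀ A B : NNFCalculus.Fml L, NNFCalculus.Derives A B →
      ∀ (M : Type w) [Nonempty M] [L.Structure M] (s : ℕ → M), A.Realize s → B.Realize s) ∧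
    (∀ A : NNFCalculus.Fml L, A.IsSentence →
      (NNFCalculus.Refutable A ↔ NNFCalculus.Fml.Contradictory.{u, v, w} A)) ∧
    (∀ A : NNFCalculus.Fml L, A.IsSentence → A.IsNNF →
      (NNFCalculus.RefutableWithinNNF A ↔ NNFCalculus.Fml.Contradictory.{u, v, w} A)) :=
  ⟨fun _ _ h _ _ _ s hA => h.realize s hA,
    fun _ hs => ⟨fun h => h.contradictory, fun h => h.refutable hs⟩,
    fun _ hs hn => ⟨fun h => h.refutable.contradictory, fun h => h.refutableWithinNNF hs hn⟩⟩
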